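/- All locally compact spaces are Hausdorff. Let $\mathcal G$ be an étale groupoid, i.e. a locally compact topological groupoid with unit space $X=\mathcal G^{(0)}$ whose range map $r:\mathcal G\to X$ is a local homeomorphism; $s$ is its source map. A locally compact groupoid $\mathcal H$ with unit space $Z$ is *amenable* if there is a net $(m_i)$ of families $m_i=(m_i^z)_{z\in Z}$ of Radon probability measures $m_i^z$ on $\mathcal H^z=r^{-1}(z)$ such that $z\mapsto m_i^z(f)$ is continuous for every $f\in C_c(\mathcal H)$ and $\lim_i\|\gamma m_i^{s(\gamma)}-m_i^{r(\gamma)}\|_1=0$ uniformly on compact subsets of $\mathcal H$. A *(left) $\mathcal G$-space* is a pair $(Y,p)$, where $Y$ is a locally compact space and $p:Y\to X$ is a continuous surjection, with a continuous action $(\gamma,y)\mapsto\gamma y$ defined for $s(\gamma)=p(y)$ such that $p(\gamma y)=r(\gamma)$, $p(y)y=y$ and $(\gamma_2\gamma_1)y=\gamma_2(\gamma_1y)$. It is *amenable* if the semidirect product groupoid $Y\rtimes\mathcal G=\{(y,\gamma): p(y)=r(\gamma)\}$ is amenable, and *fibrewise compact* if $p^{-1}(K)$ is compact for every compact $K\subset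 X$. The groupoid $\mathcal G$ is *strongly amenable at infinity* if there is an amenable fibrewise compact $\mathcal G$-space $(Y,p)$ such that $p$ has a continuous section $X\to Y$. Let $C_0(\mathcal G,r)$ be the $C^*$-algebra of bounded continuous functions $g$ on $\mathcal G$ such that for every $\varepsilon>0$ there is a compact $K\subset X$ with $|g(\gamma)|\le\varepsilon$ whenever $r(\gamma)\notin K$. Let $\beta_r\mathcal G$ be its Gelfand spectrum, $r_\beta:\beta_r\mathcal G\to X$ the map dual to $C_0(X)\to C_0(\mathcal G,r)$, $f\mapsto f\circ r$, and $\iota:\mathcal G\to\beta_r\mathcal G$ the map sending $\gamma$ to the evaluation at $\gamma$. The pair $(\beta_r\mathcal G,r_\beta)$ is the Stone–Čech fibrewise compactification of $(\mathcal G,r)$. **Proposition.** There is a unique $\mathcal G$-space structure on $(\beta_r\mathcal G,r_\beta)$ that extends the left translation action of $\mathcal G$ on itself, i.e. such that $\gamma\,\iota(\gamma')=\iota(\gamma\gamma')$ whenever $s(\gamma)=r(\gamma')$. The groupoid $\mathcal G$ is strongly amenable at infinity if and only if $(\beta_r\mathcal G,r_\beta)$ with this structure is an amenable $\mathcal G$-space.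 -/

import Mathlib

open Set Filter Topology MeasureTheory
open scoped BoundedContinuousFunction ZeroAtInfty CompactlySupported

universe u

/-! ### Topological groupoids -/

/-- A topological groupoid with space of arrows `G` and space of units `X`.  The product
`mul a b h` is defined when `s a = r b`.  Since `unit` and `r` are continuous with
`r (unit x) = x`, the map `unit` is a topological embedding: the topology of `X` is the one induced
from `G` on the set of units. -/
structure TopGroupoid (G X : Type*) [TopologicalSpace G] [TopologicalSpace X] where
  r : G → X
  s : G → X
  unit : X → G
  inv : G → G
  mul : (a b : G) → s a = r b → G
  r_unit : ∀ x, r (unit x) = x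
  s_unit : ∀ x, s (unit x) = x
  r_inv : ∀ a, r (inv a) = s a
  s_inv : ∀ a, s (inv a) = r a
  r_mul : ∀ a b h, r (mul a b h) = r a
  s_mul : ∀ a b h, s (mul a b h) = s b
  unit_mul : ∀ a, mul (unit (r a)) a (s_unit (r a)) = a
  mul_unit : ∀ a, mul a (unit (s a)) (r_unit (s a)).symm = a
  inv_mul : ∀ a, mul (inv a) a (s_inv a) = unit (s a)
  mul_inv : ∀ a, mul a (inv a) (r_inv a).symm = unit (r a)
  mul_assoc : ∀ a b c (hab : s a = r b) (hbc : s b = r c),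
    mul (mul a b hab) c ((s_mul a b hab).trans hbc) =
      mul a (mul b c hbc) (hab.trans (r_mul b c hbc).symm)
  continuous_r : Continuous r
  continuous_s : Continuous s
  continuous_unit : Continuous unit
  continuous_inv : Continuous inv
  continuous_mul : Continuous fun q : {q : G × G // s q.1 = r q.2} => mul q.1.1 q.1.2 q.2

namespace TopGroupoid

variable {G X : Type*} [TopologicalSpace G] [TopologicalSpace X]

/-- The groupoid is étale: the range map is a local homeomorphism. -/
def IsEtale (H : TopGroupoid G X) : Prop := IsLocalHomeomorph H.r

/-! ### Topological amenability -/

/-- The fibre `G^x = r⁻¹(x)`, with the subspace topology and its Borel structure. -/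
abbrev Fibre (H : TopGroupoid G X) (x : X) : Type _ := {g : G // H.r g = x}

instance (H : TopGroupoid G X) (x : X) : MeasurableSpace (H.Fibre x) := borel _

instance (H : TopGroupoid G X) (x : X) : BorelSpace (H.Fibre x) := ⟨rfl⟩

/-- Left translation `g ↦ γ g` from `G^{s(γ)}` to `G^{r(γ)}`. -/
def translate (H : TopGroupoid G X) (γ : G) (g : H.Fibre (H.s γ)) : H.Fibre (H.r γ) :=
  ⟨H.mul γ g.1 g.2.symm, H.r_mul γ g.1 g.2.symm⟩

theorem continuous_translate (H : TopGroupoid G X) (γ : G) : Continuous (H.translate γ) := by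
  have h : Continuous fun g : H.Fibre (H.s γ) =>
      (⟨(γ, g.1), g.2.symm⟩ : {q : G × G // H.s q.1 = H.r q.2}) :=
    Continuous.subtype_mk (continuous_const.prodMk continuous_subtype_val) _
  exact Continuous.subtype_mk (H.continuous_mul.comp h) _

/-- A continuous family `x ↦ m^x` of Radon probability measures `m^x` on the fibres `G^x`:
`x ↦ m^x(f)` is continuous for all continuous compactly supported `f` on `G`. -/
structure ProbFamily (H : TopGroupoid G X) where
  meas : (x : X) → Measure (H.Fibre x)
  isProbabilityMeasure : ∀ x, IsProbabilityMeasure (meas x)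
  regular : ∀ x, (meas x).Regular
  continuous : ∀ f : C_c(G, ℂ), Continuous fun x => ∫ g, f g.1 ∂(meas x)

attribute [instance] ProbFamily.isProbabilityMeasure

/-- The total variation norm `‖γ m^{s(γ)} - m^{r(γ)}‖₁`. -/
noncomputable def ProbFamily.defect {H : TopGroupoid G X} (m : H.ProbFamily) (γ : G) : ℝ :=
  (((m.meas (H.s γ)).map (H.translate γ)).toSignedMeasure
    - (m.meas (H.r γ)).toSignedMeasure).totalVariation.real univ

/-- Topological amenability: there is a net `(m_i)` of continuous families of probability measures
on the fibres of the range map with `‖γ m_i^{s(γ)} - m_i^{r(γ)}‖₁ → 0` uniformly on compact sets. -/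
def IsAmenable {G X : Type u} [TopologicalSpace G] [TopologicalSpace X]
    (H : TopGroupoid G X) : Prop :=
  ∃ (ι : Type u) (_ : Preorder ι) (_ : IsDirectedOrder ι) (_ : Nonempty ι) (m : ι → H.ProbFamily),
    ∀ K : Set G, IsCompact K → TendstoUniformlyOn (fun i γ => (m i).defect γ) 0 atTop K

end TopGroupoid

/-! ### Fibre spaces -/

/-- A fibre space `(Y, p)` over `X`: a locally compact Hausdorff space `Y` with a continuous
surjection `p : Y → X`. -/
structure FibreSpace (X Y : Type*) [TopologicalSpace X] [TopologicalSpace Y] where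
  p : Y → X
  continuous_p : Continuous p
  surjective_p : Function.Surjective p
  t2 : T2Space Y
  locallyCompact : LocallyCompactSpace Y

/-- `(Y, p)` is fibrewise compact: `p` is proper. -/
def FibreSpace.IsFibrewiseCompact {X Y : Type*} [TopologicalSpace X] [TopologicalSpace Y]
    (F : FibreSpace X Y) : Prop :=
  ∀ K : Set X, IsCompact K → IsCompact (F.p ⁻¹' K)

/-! ### `G`-spaces and their semidirect products -/

/-- A structure of left `G`-space on the fibre space `F = (Y, p)` over the unit space `X`;
`act γ y h` is defined when `s γ = p y`. -/
structure GSpace {G X Y : Type*} [TopologicalSpace G] [TopologicalSpace X] [TopologicalSpace Y]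
    (H : TopGroupoid G X) (F : FibreSpace X Y) where
  act : (γ : G) → (y : Y) → H.s γ = F.p y → Y
  p_act : ∀ γ y h, F.p (act γ y h) = H.r γ
  unit_act : ∀ y, act (H.unit (F.p y)) y (H.s_unit (F.p y)) = y
  mul_act : ∀ γ₂ γ₁ y (h : H.s γ₁ = F.p y) (h₂ : H.s γ₂ = H.r γ₁),
    act (H.mul γ₂ γ₁ h₂) y ((H.s_mul γ₂ γ₁ h₂).trans h) =
      act γ₂ (act γ₁ y h) (h₂.trans (p_act γ₁ y h).symm)
  continuous_act : Continuous fun q : {q : G × Y // H.s q.1 = F.p q.2} => act q.1.1 q.1.2 q.2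

namespace GSpace

variable {G X Y : Type*} [TopologicalSpace G] [TopologicalSpace X] [TopologicalSpace Y]
  {H : TopGroupoid G X} {F : FibreSpace X Y}

theorem act_congr (A : GSpace H F) {γ γ' : G} {y y' : Y} (hγ : γ = γ') (hy : y = y')
    (h : H.s γ = F.p y) (h' : H.s γ' = F.p y') : A.act γ y h = A.act γ' y' h' := by
  subst hγ hy; rfl

theorem _root_.TopGroupoid.mul_congr (H : TopGroupoid G X) {a a' b b' : G} (ha : a = a')
    (hb : b = b') (h : H.s a = H.r b) (h' : H.s a' = H.r b') : H.mul a b h = H.mul a' b' h' := by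
  subst ha hb; rfl

theorem _root_.TopGroupoid.continuous_mul_of (H : TopGroupoid G X) {Z : Type*}
    [TopologicalSpace Z] (f g : Z → G) (h : ∀ z, H.s (f z) = H.r (g z)) (hf : Continuous f)
    (hg : Continuous g) : Continuous fun z => H.mul (f z) (g z) (h z) :=
  H.continuous_mul.comp (f := fun z =>
    (⟨(f z, g z), h z⟩ : {q : G × G // H.s q.1 = H.r q.2})) ((hf.prodMk hg).subtype_mk h)

theorem continuous_act_of (A : GSpace H F) {Z : Type*}
    [TopologicalSpace Z] (f : Z → G) (g : Z → Y) (h : ∀ z, H.s (f z) = F.p (g z))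
    (hf : Continuous f) (hg : Continuous g) : Continuous fun z => A.act (f z) (g z) (h z) :=
  A.continuous_act.comp (f := fun z =>
    (⟨(f z, g z), h z⟩ : {q : G × Y // H.s q.1 = F.p q.2})) ((hf.prodMk hg).subtype_mk h)

theorem _root_.TopGroupoid.inv_unit (H : TopGroupoid G X) (x : X) :
    H.inv (H.unit x) = H.unit x := by
  have e : H.unit (H.r (H.inv (H.unit x))) = H.unit x := by rw [H.r_inv, H.s_unit]
  exact (H.unit_mul (H.inv (H.unit x))).symm.trans
    ((H.mul_congr e rfl _ (H.r_inv _).symm).trans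
      ((H.mul_inv (H.unit x)).trans (congrArg H.unit (H.r_unit x))))

theorem _root_.TopGroupoid.inv_mul_rev (H : TopGroupoid G X) (a b : G) (h : H.s a = H.r b)
    (h' : H.s (H.inv b) = H.r (H.inv a)) :
    H.inv (H.mul a b h) = H.mul (H.inv b) (H.inv a) h' := by
  have hs : H.s (H.inv (H.mul a b h)) = H.r a := by rw [H.s_inv, H.r_mul]
  have h1 : H.mul (H.inv (H.mul a b h)) a hs = H.inv b := by
    have e1 : H.mul (H.mul (H.inv (H.mul a b h)) a hs) b ((H.s_mul _ _ _).trans h)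
        = H.unit (H.s b) := by
      rw [H.mul_assoc _ a b hs h, H.inv_mul, H.s_mul]
    rw [← H.mul_unit (H.mul (H.inv (H.mul a b h)) a hs)]
    have e2 : H.s (H.mul (H.inv (H.mul a b h)) a hs) = H.r b := (H.s_mul _ _ _).trans h
    rw [H.mul_congr rfl ((congrArg H.unit e2).trans (H.mul_inv b).symm) _
      (by rw [e2, H.r_mul]), ← H.mul_assoc _ b (H.inv b) e2 (H.r_inv b).symm,
      H.mul_congr e1 rfl _ (by rw [H.s_unit, H.r_inv]),
      H.mul_congr (congrArg H.unit (H.r_inv b).symm) rfl _ (H.s_unit _), H.unit_mul]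
  rw [← H.mul_unit (H.inv (H.mul a b h)),
    H.mul_congr rfl ((congrArg H.unit hs).trans (H.mul_inv a).symm) _ (by rw [hs, H.r_mul]),
    ← H.mul_assoc _ a (H.inv a) hs (H.r_inv a).symm]
  exact H.mul_congr h1 rfl _ _

/-- The semidirect product groupoid `Y ⋊ G`: its space of arrows is the fibred product
`{(y, γ) : p y = r γ}`, its space of units is `Y`, and
`r (y, γ) = y`, `s (y, γ) = γ⁻¹ y`, `(y, γ) (γ⁻¹ y, γ') = (y, γ γ')`,
`(y, γ)⁻¹ = (γ⁻¹ y, γ⁻¹)`. -/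
def semidirect (A : GSpace H F) : TopGroupoid {q : Y × G // F.p q.1 = H.r q.2} Y where
  r q := q.1.1
  s q := A.act (H.inv q.1.2) q.1.1 ((H.s_inv q.1.2).trans q.2.symm)
  unit y := ⟨(y, H.unit (F.p y)), (H.r_unit (F.p y)).symm⟩
  inv q := ⟨(A.act (H.inv q.1.2) q.1.1 ((H.s_inv q.1.2).trans q.2.symm), H.inv q.1.2),
    A.p_act _ _ _⟩
  mul a b h := ⟨(a.1.1, H.mul a.1.2 b.1.2
      (((H.r_inv a.1.2).symm.trans (A.p_act _ _ _).symm).trans ((congrArg F.p h).trans b.2))),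
    a.2.trans (H.r_mul _ _ _).symm⟩
  r_unit _ := rfl
  s_unit y := (A.act_congr (H.inv_unit _) rfl _ _).trans (A.unit_act y)
  r_inv _ := rfl
  s_inv a := by
    refine (A.mul_act _ _ _ ((H.s_inv a.1.2).trans a.2.symm) (H.s_inv _)).symm.trans ?_
    refine (A.act_congr ?_ rfl _ (H.s_unit _)).trans (A.unit_act a.1.1)
    rw [H.inv_mul, H.s_inv, a.2]
  r_mul _ _ _ := rfl
  s_mul a b h := by
    have h1 : H.s a.1.2 = H.r b.1.2 :=
      ((H.r_inv a.1.2).symm.trans (A.p_act _ _ _).symm).trans ((congrArg F.p h).trans b.2)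
    have h2 : H.s (H.inv b.1.2) = H.r (H.inv a.1.2) := by rw [H.s_inv, H.r_inv, h1]
    refine (A.act_congr (H.inv_mul_rev a.1.2 b.1.2 h1 h2) rfl _
      ((H.s_mul _ _ _).trans ((H.s_inv a.1.2).trans a.2.symm))).trans ?_
    refine (A.mul_act _ _ _ ((H.s_inv a.1.2).trans a.2.symm) h2).trans ?_
    exact A.act_congr rfl h _ _
  unit_mul a := by
    apply Subtype.ext
    refine Prod.ext rfl ?_
    exact (H.mul_congr (congrArg H.unit a.2) rfl _ (H.s_unit _)).trans (H.unit_mul a.1.2)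
  mul_unit a := by
    apply Subtype.ext
    refine Prod.ext rfl ?_
    refine (H.mul_congr rfl (congrArg H.unit ?_) _ (H.r_unit _).symm).trans (H.mul_unit a.1.2)
    exact (A.p_act _ _ _).trans (H.r_inv _)
  inv_mul a := by
    apply Subtype.ext
    refine Prod.ext rfl ?_
    refine (H.inv_mul a.1.2).trans (congrArg H.unit ?_)
    exact ((A.p_act _ _ _).trans (H.r_inv _)).symm
  mul_inv a := by
    apply Subtype.ext
    refine Prod.ext rfl ?_
    exact (H.mul_inv a.1.2).trans (congrArg H.unit a.2.symm)
  mul_assoc a b c hab hbc := by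
    apply Subtype.ext
    refine Prod.ext rfl ?_
    exact H.mul_assoc a.1.2 b.1.2 c.1.2 _ _
  continuous_r := continuous_fst.comp continuous_subtype_val
  continuous_s := by
    exact A.continuous_act_of _ _ _ (H.continuous_inv.comp
      (continuous_snd.comp continuous_subtype_val)) (continuous_fst.comp continuous_subtype_val)
  continuous_unit := Continuous.subtype_mk
    (continuous_id.prodMk (H.continuous_unit.comp F.continuous_p)) _
  continuous_inv := by
    refine Continuous.subtype_mk (Continuous.prodMk ?_ (H.continuous_inv.comp
      (continuous_snd.comp continuous_subtype_val))) _
    exact A.continuous_act_of _ _ _ (H.continuous_inv.comp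
      (continuous_snd.comp continuous_subtype_val)) (continuous_fst.comp continuous_subtype_val)
  continuous_mul := by
    refine Continuous.subtype_mk (Continuous.prodMk (continuous_fst.comp
      (continuous_subtype_val.comp (continuous_fst.comp continuous_subtype_val))) ?_) _
    refine H.continuous_mul_of _ _ _ ?_ ?_
    · exact continuous_snd.comp
        (continuous_subtype_val.comp (continuous_fst.comp continuous_subtype_val))
    · exact continuous_snd.comp
        (continuous_subtype_val.comp (continuous_snd.comp continuous_subtype_val))

end GSpace

/-- A `G`-space is amenable if its semidirect product groupoid is amenable. -/
def GSpace.IsAmenable {G X Y : Type u} [TopologicalSpace G] [TopologicalSpace X]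
    [TopologicalSpace Y] {H : TopGroupoid G X} {F : FibreSpace X Y} (A : GSpace H F) : Prop :=
  A.semidirect.IsAmenable

/-- Strong amenability at infinity: there is an amenable fibrewise compact `G`-space `(Y, p)` such
that `p` has a continuous section. -/
def TopGroupoid.IsStronglyAmenableAtInfinity {G X : Type u} [TopologicalSpace G]
    [TopologicalSpace X] (H : TopGroupoid G X) : Prop :=
  ∃ (Y : Type u) (_ : TopologicalSpace Y) (F : FibreSpace X Y) (A : GSpace H F),
    F.IsFibrewiseCompact ∧ A.IsAmenable ∧
      ∃ σ : X → Y, Continuous σ ∧ ∀ x, F.p (σ x) = x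

/-- The fibre space `r : G → X` of a locally compact groupoid. -/
def TopGroupoid.rangeFibreSpace {G X : Type*} [TopologicalSpace G] [TopologicalSpace X]
    [T2Space G] [LocallyCompactSpace G] (H : TopGroupoid G X) : FibreSpace X G where
  p := H.r
  continuous_p := H.continuous_r
  surjective_p x := ⟨H.unit x, H.r_unit x⟩
  t2 := inferInstance
  locallyCompact := inferInstance

/-- The left `G`-space structure of `r : G → X`, given by left translations. -/
def TopGroupoid.leftTranslation {G X : Type*} [TopologicalSpace G] [TopologicalSpace X]
    [T2Space G] [LocallyCompactSpace G] (H : TopGroupoid G X) : GSpace H H.rangeFibreSpace where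
  act γ g h := H.mul γ g h
  p_act γ g h := H.r_mul γ g h
  unit_act g := H.unit_mul g
  mul_act γ₂ γ₁ g h h₂ := H.mul_assoc γ₂ γ₁ g h₂ h
  continuous_act := H.continuous_mul

/-! ### The Stone–Čech fibrewise compactification -/

namespace FibreSpace

variable {X Y : Type*} [TopologicalSpace X] [TopologicalSpace Y]

/-- The C*-algebra `C₀(Y, p)` of continuous bounded functions `g` on `Y` such that for every `ε > 0`
there is a compact `K ⊆ X` with `|g y| ≤ ε` for `y ∉ p⁻¹(K)`. -/
noncomputable def c0 (F : FibreSpace X Y) : NonUnitalStarSubalgebra ℂ (Y →ᵇ ℂ) where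
  carrier := {g | ∀ ε : ℝ, 0 < ε → ∃ K : Set X, IsCompact K ∧ ∀ y, F.p y ∉ K → ‖g y‖ ≤ ε}
  add_mem' := by
    intro a b ha hb ε hε
    obtain ⟨K, hK, h⟩ := ha (ε / 2) (by positivity)
    obtain ⟨L, hL, h'⟩ := hb (ε / 2) (by positivity)
    refine ⟨K ∪ L, hK.union hL, fun y hy => ?_⟩
    have h1 := h y fun hk => hy (Or.inl hk)
    have h2 := h' y fun hk => hy (Or.inr hk)
    have h3 : ‖(a + b) y‖ ≤ ‖a y‖ + ‖b y‖ := norm_add_le _ _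
    linarith
  zero_mem' := fun ε hε => ⟨∅, isCompact_empty, fun y _ => by simpa using hε.le⟩
  mul_mem' := by
    intro a b _ hb ε hε
    have ha : 0 < ‖a‖ + 1 := by positivity
    obtain ⟨K, hK, h⟩ := hb (ε / (‖a‖ + 1)) (by positivity)
    refine ⟨K, hK, fun y hy => ?_⟩
    have h1 := h y hy
    have h2 : ‖a y‖ ≤ ‖a‖ + 1 := (a.norm_coe_le_norm y).trans (by linarith)
    calc ‖(a * b) y‖ = ‖a y‖ * ‖b y‖ := norm_mul _ _
      _ ≤ (‖a‖ + 1) * (ε / (‖a‖ + 1)) := by gcongr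
      _ = ε := by field_simp
  smul_mem' := by
    intro c a ha ε hε
    have hc : 0 < ‖c‖ + 1 := by positivity
    obtain ⟨K, hK, h⟩ := ha (ε / (‖c‖ + 1)) (by positivity)
    refine ⟨K, hK, fun y hy => ?_⟩
    have h1 := h y hy
    calc ‖(c • a) y‖ = ‖c‖ * ‖a y‖ := norm_smul c (a y)
      _ ≤ (‖c‖ + 1) * (ε / (‖c‖ + 1)) := by gcongr; linarith
      _ = ε := by field_simp
  star_mem' := by
    intro a ha ε hε
    obtain ⟨K, hK, h⟩ := ha ε hε
    exact ⟨K, hK, fun y hy => by simpa using h y hy⟩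

/-- `β_p Y`: the Gelfand spectrum of `C₀(Y, p)`, that is, the space of nonzero continuous
multiplicative linear functionals on `C₀(Y, p)` with the weak-* topology. -/
abbrev Beta (F : FibreSpace X Y) : Type _ := WeakDual.characterSpace ℂ F.c0

/-- The inclusion `f ↦ f ∘ p` of `C₀(X)` into `C₀(Y, p)`. -/
noncomputable def pull (F : FibreSpace X Y) : C₀(X, ℂ) →⋆ₙₐ[ℂ] F.c0 where
  toFun f := ⟨f.toBCF.compContinuous ⟨F.p, F.continuous_p⟩, by
    intro ε hε
    have h := f.zero_at_infty'
    rw [Metric.tendsto_nhds] at h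
    obtain ⟨K, hK, hKs⟩ := mem_cocompact.1 (h ε hε)
    refine ⟨K, hK, fun y hy => ?_⟩
    have h' := hKs hy
    simp only [mem_ofPred_eq, dist_zero_right] at h'
    exact h'.le⟩
  map_smul' _ _ := rfl
  map_zero' := rfl
  map_add' _ _ := rfl
  map_mul' _ _ := rfl
  map_star' _ := rfl

theorem continuous_beta_apply (F : FibreSpace X Y) (g : F.c0) :
    Continuous fun χ : F.Beta => χ g :=
  (WeakDual.eval_continuous g).comp continuous_subtype_val

theorem locallyCompact_beta (F : FibreSpace X Y) : LocallyCompactSpace F.Beta := by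
  have hnorm : ∀ φ ∈ WeakDual.characterSpace ℂ F.c0 ∪ {0}, ‖WeakDual.toStrongDual φ‖ ≤ 1 := by
    intro φ hφ
    rw [WeakDual.CharacterSpace.union_zero] at hφ
    set T : StrongDual ℂ F.c0 := WeakDual.toStrongDual φ with hT
    have hmul : ∀ a : F.c0, T (a * a) = T a * T a := fun a => hφ a a
    have hsq : ‖T‖ ≤ √‖T‖ := by
      refine T.opNorm_le_bound (Real.sqrt_nonneg _) fun a => ?_
      have h1 : ‖T a‖ ^ 2 ≤ ‖T‖ * ‖a‖ ^ 2 := by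
        calc ‖T a‖ ^ 2 = ‖T (a * a)‖ := by rw [hmul, norm_mul, sq]
          _ ≤ ‖T‖ * ‖a * a‖ := T.le_opNorm _
          _ ≤ ‖T‖ * (‖a‖ * ‖a‖) := by gcongr; exact norm_mul_le a a
          _ = ‖T‖ * ‖a‖ ^ 2 := by ring
      refine abs_le_of_sq_le_sq' ?_ (by positivity) |>.2
      rw [mul_pow, Real.sq_sqrt (show 0 ≤ ‖T‖ from T.opNorm_nonneg)]
      exact h1
    by_contra hlt
    push Not at hlt
    have h2 : √‖T‖ * √‖T‖ = ‖T‖ := Real.mul_self_sqrt T.opNorm_nonneg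
    have h3 : 1 < √‖T‖ := by rw [Real.lt_sqrt (by norm_num)]; simpa using hlt
    nlinarith
  have hcomp : IsCompact (WeakDual.characterSpace ℂ F.c0 ∪ {0}) := by
    refine (WeakDual.isCompact_closedBall (0 : StrongDual ℂ F.c0) 1).of_isClosed_subset
      (WeakDual.CharacterSpace.union_zero_isClosed ℂ F.c0) fun φ hφ => ?_
    simpa using hnorm φ hφ
  have hsub : WeakDual.characterSpace ℂ F.c0 ⊆ WeakDual.characterSpace ℂ F.c0 ∪ {0} :=
    subset_union_left
  have : CompactSpace (WeakDual.characterSpace ℂ F.c0 ∪ {0} : Set (WeakDual ℂ F.c0)) :=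
    isCompact_iff_compactSpace.1 hcomp
  have hemb : IsOpenEmbedding (inclusion hsub) := by
    refine ⟨IsEmbedding.inclusion hsub, ?_⟩
    have hr : range (inclusion hsub) = Subtype.val ⁻¹' ({0}ᶜ : Set (WeakDual ℂ F.c0)) := by
      ext φ
      constructor
      · rintro ⟨ψ, rfl⟩
        exact ψ.2.1
      · intro h
        exact ⟨⟨φ.1, φ.2.resolve_right h⟩, rfl⟩
    rw [hr]
    exact isOpen_compl_singleton.preimage continuous_subtype_val
  exact hemb.locallyCompactSpace

variable [T2Space X] [LocallyCompactSpace X]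

/-- Urysohn functions in `C₀(X)`. -/
theorem exists_bump {K U : Set X} (hK : IsCompact K) (hU : IsOpen U) (hKU : K ⊆ U) :
    ∃ f : C₀(X, ℂ), (∀ x ∈ K, f x = 1) ∧ (∀ x, x ∉ U → f x = 0) ∧ HasCompactSupport f ∧
      ∀ x, ‖1 - f x‖ ≤ 1 := by
  obtain ⟨f, h1, h2, h3, h4⟩ := exists_continuousMap_one_of_isCompact_subset_isOpen hK hU hKU
  let g : C(X, ℂ) := ⟨fun x => (f x : ℂ), Complex.continuous_ofReal.comp f.continuous⟩
  have hg : HasCompactSupport g :=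
    HasCompactSupport.comp_left (g := ((↑) : ℝ → ℂ)) (f := f) h2 Complex.ofReal_zero
  refine ⟨⟨g, ?_⟩, fun x hx => ?_, fun x hx => ?_, hg, fun x => ?_⟩
  · exact hg.is_zero_at_infty
  · have : f x = 1 := h1 hx
    simp [g, this]
  · have : f x = 0 := image_eq_zero_of_notMem_tsupport fun h => hx (h3 h)
    simp [g, this]
  · have h5 : (1 - (f x : ℂ)) = ((1 - f x : ℝ) : ℂ) := by push_cast; rfl
    change ‖1 - (f x : ℂ)‖ ≤ 1
    rw [h5, Complex.norm_real, Real.norm_eq_abs, abs_le]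
    constructor <;> linarith [(h4 x).1, (h4 x).2]

/-- A character of `C₀(Y, p)` does not vanish on the image of `C₀(X)`. -/
theorem exists_pull_ne_zero (F : FibreSpace X Y) (χ : F.Beta) :
    ∃ f : C₀(X, ℂ), HasCompactSupport f ∧ χ (F.pull f) ≠ 0 := by
  by_contra! hcon
  refine χ.2.1 (DFunLike.ext _ _ fun g => ?_)
  change χ g = 0
  have hχ : Continuous χ := map_continuous χ
  have hmem : g ∈ closure {a : F.c0 | χ a = 0} := by
    rw [Metric.mem_closure_iff]
    intro ε hε
    obtain ⟨K, hK, h⟩ := g.2 (ε / 2) (by positivity)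
    obtain ⟨f, hf1, -, hfc, hf⟩ := exists_bump hK isOpen_univ (subset_univ K)
    refine ⟨g * F.pull f, ?_, ?_⟩
    · change χ (g * F.pull f) = 0
      rw [map_mul, hcon f hfc, mul_zero]
    · refine lt_of_le_of_lt ?_ (half_lt_self hε)
      change dist (g : Y →ᵇ ℂ) ((g * F.pull f : F.c0) : Y →ᵇ ℂ) ≤ ε / 2
      rw [BoundedContinuousFunction.dist_le (by positivity)]
      intro y
      have e : (g : Y →ᵇ ℂ) y - ((g * F.pull f : F.c0) : Y →ᵇ ℂ) y
          = (g : Y →ᵇ ℂ) y * (1 - f (F.p y)) := by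
        change (g : Y →ᵇ ℂ) y - (g : Y →ᵇ ℂ) y * f (F.p y) = _
        ring
      rw [dist_eq_norm, e, norm_mul]
      by_cases hy : F.p y ∈ K
      · rw [hf1 _ hy]; simp; positivity
      · calc _ ≤ (ε / 2) * 1 := by
              gcongr
              · exact h y hy
              · exact hf _
          _ = ε / 2 := mul_one _
  have hcl : IsClosed {a : F.c0 | χ a = 0} := isClosed_eq hχ continuous_const
  exact hcl.closure_subset hmem

/-- The restriction of a character of `C₀(Y, p)` along `f ↦ f ∘ p` is the evaluation at a unique
point of `X`. -/
theorem existsUnique_proj (F : FibreSpace X Y) (χ : F.Beta) :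
    ∃! x : X, ∀ f : C₀(X, ℂ), χ (F.pull f) = f x := by
  obtain ⟨e, hec, he⟩ := F.exists_pull_ne_zero χ
  have key : ∃ x : X, ∀ f : C₀(X, ℂ), χ (F.pull f) = 0 → f x = 0 := by
    by_contra! hcon
    choose f hf0 hfx using hcon
    have hcomp : IsCompact (tsupport e) := hec
    obtain ⟨t, ht⟩ := hcomp.elim_finite_subcover (fun x => {z | f x z ≠ 0})
      (fun x => isOpen_ne_fun (map_continuous (f x)) continuous_const)
      (fun z _ => mem_iUnion.2 ⟨z, hfx z⟩)
    let S : C₀(X, ℂ) := ∑ x ∈ t, f x * star (f x)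
    have hSapp : ∀ z, S z = ((∑ x ∈ t, ‖f x z‖ ^ 2 : ℝ) : ℂ) := by
      intro z
      have : S z = ∑ x ∈ t, (f x * star (f x)) z := by
        exact map_sum (⟨⟨fun g : C₀(X, ℂ) => g z, rfl⟩, fun _ _ => rfl⟩ : C₀(X, ℂ) →+ ℂ) _ t
      rw [this]
      push_cast
      refine Finset.sum_congr rfl fun x _ => ?_
      have : (f x * star (f x)) z = f x z * (starRingEnd ℂ) (f x z) := rfl
      rw [this, Complex.mul_conj, Complex.normSq_eq_norm_sq]
      push_cast; rfl
    have hSne : ∀ z ∈ tsupport e, S z ≠ 0 := by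
      intro z hz
      obtain ⟨x, hx⟩ := mem_iUnion.1 (ht hz)
      obtain ⟨hxt, hx⟩ := mem_iUnion.1 hx
      rw [hSapp]
      have : 0 < ∑ x ∈ t, ‖f x z‖ ^ 2 :=
        Finset.sum_pos' (fun _ _ => by positivity)
          ⟨x, hxt, by have : f x z ≠ 0 := hx; positivity⟩
      exact_mod_cast this.ne'
    have hSχ : χ (F.pull S) = 0 := by
      simp only [S, map_sum, map_mul]
      exact Finset.sum_eq_zero fun x _ => by rw [hf0 x, zero_mul]
    -- the quotient `e / S` is continuous with compact support
    have hq : Continuous fun z => e z / S z := by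
      rw [continuous_iff_continuousAt]
      intro z
      by_cases hz : z ∈ tsupport e
      · exact (map_continuous e).continuousAt.div (map_continuous S).continuousAt (hSne z hz)
      · have h0 : (fun z => e z / S z) =ᶠ[𝓝 z] fun _ => 0 := by
          filter_upwards [(isClosed_tsupport e).isOpen_compl.mem_nhds hz] with w hw
          rw [image_eq_zero_of_notMem_tsupport hw, zero_div]
        exact continuousAt_const.congr h0.symm
    let q : C(X, ℂ) := ⟨fun z => e z / S z, hq⟩
    have hqc : HasCompactSupport q := by
      refine hec.mono' ?_
      intro z hz
      refine subset_tsupport e ?_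
      intro h0
      exact hz (by change e z / S z = 0; rw [h0, zero_div])
    let q' : C₀(X, ℂ) := ⟨q, hqc.is_zero_at_infty⟩
    have hfac : e = S * q' := by
      ext z
      change e z = S z * (e z / S z)
      by_cases hz : z ∈ tsupport e
      · rw [mul_div_cancel₀ _ (hSne z hz)]
      · rw [image_eq_zero_of_notMem_tsupport hz, zero_div, mul_zero]
    apply he
    rw [hfac, map_mul, map_mul, hSχ, zero_mul]
  obtain ⟨x, hx⟩ := key
  have hdiff : ∀ f g : C₀(X, ℂ), χ (F.pull f) = χ (F.pull g) → f x = g x := by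
    intro f g h
    have h1 := hx (f - g) (by rw [map_sub, map_sub, h, sub_self])
    exact sub_eq_zero.1 h1
  have hsmul : ∀ f : C₀(X, ℂ), χ (F.pull e) * f x = χ (F.pull f) * e x := by
    intro f
    have h1 := hdiff (χ (F.pull e) • f) (χ (F.pull f) • e) (by
      simp only [map_smul, smul_eq_mul]; ring)
    exact h1
  obtain ⟨b, hb, -, -, -⟩ := exists_bump (isCompact_singleton (x := x)) isOpen_univ
    (subset_univ _)
  have hbx : b x = 1 := hb x rfl
  have hex : e x ≠ 0 := by
    intro h0
    have h1 := hsmul b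
    rw [h0, hbx, mul_zero, mul_one] at h1
    exact he h1
  have hee : χ (F.pull e) = e x := by
    have h1 := hsmul (e * e)
    rw [map_mul, map_mul] at h1
    have h2 : (e * e) x = e x * e x := rfl
    rw [h2] at h1
    have h3 : χ (F.pull e) * e x ≠ 0 := mul_ne_zero he hex
    have h4 : (χ (F.pull e) * e x) * e x = (χ (F.pull e) * e x) * χ (F.pull e) := by
      linear_combination h1
    exact (mul_left_cancel₀ h3 h4).symm
  refine ⟨x, fun f => ?_, fun x' hx' => ?_⟩
  · have h1 := hsmul f
    rw [hee, mul_comm] at h1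
    exact (mul_right_cancel₀ hex h1).symm
  · by_contra hne
    obtain ⟨f, hf1, hf0, -, -⟩ := exists_bump (isCompact_singleton (x := x))
      (isOpen_compl_singleton (x := x')) (by simpa using fun h : x' = x => hne h)
    have h1 := hdiff f (f * f) (by
      rw [map_mul, map_mul, hx' f, hf0 x' (by simp), mul_zero])
    have h2 : χ (F.pull f) = 0 := by rw [hx' f, hf0 x' (by simp)]
    have h3 := hx f h2
    rw [hf1 x rfl] at h3
    exact one_ne_zero h3

/-- The map `p_β : β_p Y → X` dual to the inclusion `C₀(X) → C₀(Y, p)`: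
`χ (f ∘ p) = f (p_β χ)` for all `f ∈ C₀(X)`. -/
noncomputable def betaProj (F : FibreSpace X Y) (χ : F.Beta) : X := (F.existsUnique_proj χ).choose

theorem betaProj_spec (F : FibreSpace X Y) (χ : F.Beta) (f : C₀(X, ℂ)) :
    χ (F.pull f) = f (F.betaProj χ) :=
  (F.existsUnique_proj χ).choose_spec.1 f

/-- The canonical map `Y → β_p Y` sending `y` to the evaluation at `y`. -/
noncomputable def toBeta (F : FibreSpace X Y) (y : Y) : F.Beta :=
  ⟨(⟨{ toFun := fun g => (g : Y →ᵇ ℂ) y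
       map_add' := fun _ _ => rfl
       map_smul' := fun _ _ => rfl },
      ((continuous_apply y).comp BoundedContinuousFunction.continuous_coe).comp
        continuous_subtype_val⟩ :
      F.c0 →L[ℂ] ℂ), by
    refine ⟨fun h => ?_, fun _ _ => rfl⟩
    obtain ⟨f, hf, -, -, -⟩ := exists_bump (isCompact_singleton (x := F.p y)) isOpen_univ
      (subset_univ _)
    have h1 : f (F.p y) = 0 := DFunLike.congr_fun h (F.pull f)
    rw [hf _ rfl] at h1
    exact one_ne_zero h1⟩

theorem toBeta_apply (F : FibreSpace X Y) (y : Y) (g : F.c0) :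
    F.toBeta y g = (g : Y →ᵇ ℂ) y := rfl

theorem betaProj_toBeta (F : FibreSpace X Y) (y : Y) : F.betaProj (F.toBeta y) = F.p y :=
  (F.existsUnique_proj (F.toBeta y)).unique (F.betaProj_spec _) fun _ => rfl

theorem continuous_betaProj (F : FibreSpace X Y) : Continuous F.betaProj := by
  rw [continuous_iff_continuousAt]
  intro χ
  rw [ContinuousAt, tendsto_nhds]
  intro U hU hχU
  obtain ⟨f, hf1, hf0, -, -⟩ := exists_bump (isCompact_singleton (x := F.betaProj χ)) hU
    (by simpa using hχU)
  have h1 : {ψ : F.Beta | ψ (F.pull f) ≠ 0} ∈ 𝓝 χ := by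
    refine (isOpen_ne_fun (F.continuous_beta_apply _) continuous_const).mem_nhds ?_
    change χ (F.pull f) ≠ 0
    rw [F.betaProj_spec, hf1 _ rfl]
    exact one_ne_zero
  filter_upwards [h1] with ψ hψ
  by_contra hcon
  exact hψ (by rw [F.betaProj_spec, hf0 _ hcon])

/-- The Stone–Čech fibrewise compactification `(β_p Y, p_β)`, as a fibre space over `X`. -/
noncomputable def beta (F : FibreSpace X Y) : FibreSpace X F.Beta where
  p := F.betaProj
  continuous_p := F.continuous_betaProj
  surjective_p x := by
    obtain ⟨y, rfl⟩ := F.surjective_p x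
    exact ⟨F.toBeta y, F.betaProj_toBeta y⟩
  t2 := inferInstance
  locallyCompact := F.locallyCompact_beta

end FibreSpace

/-- An action `B` of `H` on `(β_p Y, p_β)` extends the action `A` on `(Y, p)`:
`γ ι(y) = ι(γ y)`, where `ι : Y → β_p Y` is the canonical map. -/
def GSpace.Extends {G X Y : Type*} [TopologicalSpace G] [TopologicalSpace X] [TopologicalSpace Y]
    [T2Space X] [LocallyCompactSpace X] {H : TopGroupoid G X} {F : FibreSpace X Y}
    (B : GSpace H F.beta) (A : GSpace H F) : Prop :=
  ∀ γ y (h : H.s γ = F.p y),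
    B.act γ (F.toBeta y) (h.trans (F.betaProj_toBeta y).symm) = F.toBeta (A.act γ y h)

/-! ### Étale groupoids -/

namespace TopGroupoid

variable {G X : Type*} [TopologicalSpace G] [TopologicalSpace X]

/-! The action on `β_r G` is dual to translation of functions: `(γχ)(g) = χ(g(γ·))`. The function `a
↦ g(γa)` lives only on the fibre over `s γ`. Étaleness supplies a local section of `s` through `γ`,
and translating by that section, with a cutoff over `X`, gives an element of `C₀(G, r)`
(`exists_isTranslate`). The choices do not matter, because `χ` sees a function only near `p_β χ`
(`beta_apply_congr`). One translate serves all arrows near `γ`, which gives joint continuity of the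
action. The identities `p(γχ) = r γ` and uniqueness follow from density: `G` is dense in `β_r G` and
`s` is open, so the pairs `(γ, ι(a))` are dense in the fibred product (`eq_of_eq_toBeta`).

If `β_r G` is amenable, it witnesses strong amenability at infinity itself: it is fibrewise compact
and `x ↦ ι(unit x)` is a section. Conversely, for an amenable fibrewise compact `Y` with section
`σ`, the map `a ↦ a σ(s a)` is an equivariant fibre map `G → Y`. Fibrewise compactness extends it to
`β_r G`, and density keeps it equivariant (`exists_equivariant`).

Amenability then pulls back along an equivariant map `f : Z → Y` (`of_equivariant`): the fibre of `Z
⋊ G` over `z` and that of `Y ⋊ G` over `f z` are both copies of one fibre of `r`, so the measures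
can be transported without changing the defect. The analytic point is continuity of the transported
family (`continuous_integral_pullback`). -/

theorem inv_inv (H : TopGroupoid G X) (a : G) : H.inv (H.inv a) = a := by
  have hs : H.s (H.inv (H.inv a)) = H.r (H.inv a) := H.s_inv _
  have e1 : H.s (H.inv (H.inv a)) = H.s a := hs.trans (H.r_inv a)
  rw [← H.mul_unit (H.inv (H.inv a)),
    H.mul_congr rfl ((congrArg H.unit e1).trans (H.inv_mul a).symm) _
      (by rw [hs, H.r_mul]), ← H.mul_assoc _ (H.inv a) a hs (H.s_inv a),
    H.mul_congr ((H.inv_mul (H.inv a)).trans (congrArg H.unit (H.s_inv a))) rfl _ (H.s_unit _),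
    H.unit_mul]

theorem mul_mul_inv (H : TopGroupoid G X) (a c : G) (h : H.s a = H.r c)
    (h' : H.s (H.mul a c h) = H.r (H.inv c)) : H.mul (H.mul a c h) (H.inv c) h' = a := by
  rw [H.mul_assoc a c _ h (H.r_inv c).symm,
    H.mul_congr rfl ((H.mul_inv c).trans (congrArg H.unit h.symm)) _ (H.r_unit _).symm, H.mul_unit]

theorem mul_inv_mul (H : TopGroupoid G X) (a c : G) (h : H.s a = H.r (H.inv c))
    (h' : H.s (H.mul a (H.inv c) h) = H.r c) : H.mul (H.mul a (H.inv c) h) c h' = a := by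
  have e : H.s a = H.s c := h.trans (H.r_inv c)
  rw [H.mul_assoc a _ c h (H.s_inv c),
    H.mul_congr rfl ((H.inv_mul c).trans (congrArg H.unit e.symm)) _ (H.r_unit _).symm, H.mul_unit]

/-- Inversion as a homeomorphism. -/
def invHomeomorph (H : TopGroupoid G X) : G ≃ₜ G where
  toFun := H.inv
  invFun := H.inv
  left_inv := H.inv_inv
  right_inv := H.inv_inv
  continuous_toFun := H.continuous_inv
  continuous_invFun := H.continuous_inv

theorem IsEtale.isLocalHomeomorph_s {H : TopGroupoid G X} (hH : H.IsEtale) :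
    IsLocalHomeomorph H.s := by
  have h : IsLocalHomeomorph (H.r ∘ H.invHomeomorph) :=
    IsLocalHomeomorph.comp hH H.invHomeomorph.isLocalHomeomorph
  have e : H.r ∘ H.invHomeomorph = H.s := funext H.r_inv
  rwa [e] at h

theorem IsEtale.isOpenMap_s {H : TopGroupoid G X} (hH : H.IsEtale) : IsOpenMap H.s :=
  hH.isLocalHomeomorph_s.isOpenMap

/-- `h` is the left translate of `g` by `γ'`, for all `γ'` close to `γ`. -/
def IsTranslate {E : Type*} (H : TopGroupoid G X) (γ : G) (g h : G → E) : Prop :=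
  ∀ᶠ γ' in 𝓝 γ, ∀ (a : G) (e : H.s γ' = H.r a), h a = g (H.mul γ' a e)

theorem IsTranslate.eventually {E : Type*} {H : TopGroupoid G X} {γ : G} {g h : G → E}
    (hh : H.IsTranslate γ g h) : ∀ᶠ γ' in 𝓝 γ, H.IsTranslate γ' g h :=
  eventually_eventually_nhds.2 hh

/-- Since `s` is open, the sources of arrows near `γ` fill a neighbourhood of `s γ`, and over each
such source both functions are given by the same formula. -/
theorem IsTranslate.eventually_eq {E : Type*} {H : TopGroupoid G X} (hH : H.IsEtale) {γ : G}
    {g h h' : G → E} (hh : H.IsTranslate γ g h) (hh' : H.IsTranslate γ g h') :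
    ∀ᶠ x in 𝓝 (H.s γ), ∀ a, H.r a = x → h a = h' a := by
  have := (hh.and hh')
  have h1 := hH.isOpenMap_s.image_mem_nhds this
  filter_upwards [h1]
  rintro x ⟨γ', ⟨h2, h3⟩, rfl⟩ a ha
  rw [h2 a ha.symm, h3 a ha.symm]

/-- The units of an étale groupoid are open: `γ` is a unit if it is close to a unit. -/
theorem IsEtale.eventually_eq_unit {H : TopGroupoid G X} (hH : H.IsEtale) (x : X) :
    ∀ᶠ γ in 𝓝 (H.unit x), γ = H.unit (H.r γ) := by
  obtain ⟨e, hxe, her⟩ := hH (H.unit x)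
  have h1 : e.source ∈ 𝓝 (H.unit (H.r (H.unit x))) := by
    rw [H.r_unit]; exact e.open_source.mem_nhds hxe
  filter_upwards [e.open_source.mem_nhds hxe,
    (H.continuous_unit.comp H.continuous_r).continuousAt.eventually h1] with γ h2 h3
  -- Both `γ` and `unit (r γ)` lie in a chart on which `r` is injective, and they have the same
  -- range.
  refine e.injOn h2 h3 ?_
  rw [← her]
  exact (H.r_unit _).symm

/-- Arrows `v` near `γ₂γ₁` factor continuously as `v = d v · c v`: a local section of `s` through
`γ₁` gives `c v` with the source of `v`, and `d v = v (c v)⁻¹`. Then `c v` is near `γ₁` and `d v`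
near `γ₂`, so the two translation formulas compose. -/
theorem IsEtale.isTranslate_mul {E : Type*} {H : TopGroupoid G X} (hH : H.IsEtale) {γ₁ γ₂ : G}
    (h : H.s γ₂ = H.r γ₁) {g k l : G → E} (hk : H.IsTranslate γ₂ g k) (hl : H.IsTranslate γ₁ k l) :
    H.IsTranslate (H.mul γ₂ γ₁ h) g l := by
  obtain ⟨e, hγe, hes⟩ := hH.isLocalHomeomorph_s γ₁
  let V : Set G := H.s ⁻¹' e.target
  have hV : IsOpen V := e.open_target.preimage H.continuous_s
  have hs : ∀ v : V, H.s (e.symm (H.s v.1)) = H.s v.1 := fun v => by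
    rw [hes, e.right_inv (by rw [← hes]; exact v.2)]
  let c : V → G := fun v => e.symm (H.s v.1)
  have hsc : ∀ v, H.s v.1 = H.r (H.inv (c v)) := fun v => by rw [H.r_inv]; exact (hs v).symm
  let d : V → G := fun v => H.mul v.1 (H.inv (c v)) (hsc v)
  have hc : Continuous c := e.continuousOn_symm.comp_continuous
    (H.continuous_s.comp continuous_subtype_val) fun v => v.2
  have hd : Continuous d := H.continuous_mul_of _ _ hsc continuous_subtype_val
    (H.continuous_inv.comp hc)
  have hsm : H.s (H.mul γ₂ γ₁ h) = e γ₁ := by rw [H.s_mul, hes]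
  let v₀ : V := ⟨H.mul γ₂ γ₁ h, by
    change H.s _ ∈ e.target
    rw [hsm]; exact e.map_source hγe⟩
  have hc0 : c v₀ = γ₁ := by
    change e.symm (H.s (H.mul γ₂ γ₁ h)) = γ₁
    rw [hsm, e.left_inv hγe]
  have hd0 : d v₀ = γ₂ :=
    (H.mul_congr rfl (congrArg H.inv hc0) _
      ((H.s_mul _ _ _).trans (H.r_inv _).symm)).trans (H.mul_mul_inv γ₂ γ₁ h _)
  have key : ∀ᶠ v in 𝓝 v₀, ∀ (a : G) (ha : H.s v.1 = H.r a), l a = g (H.mul v.1 a ha) := by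
    rw [← hc0] at hl
    rw [← hd0] at hk
    filter_upwards [hc.continuousAt.eventually hl, hd.continuousAt.eventually hk] with v h1 h2 a ha
    have h3 : H.s (d v) = H.r (c v) := (H.s_mul _ _ _).trans (H.s_inv _)
    have h4 : H.s (c v) = H.r a := (hs v).trans ha
    rw [h1 a h4, h2 _ (h3.trans (H.r_mul _ _ _).symm), ← H.mul_assoc _ _ _ h3 h4,
      H.mul_congr (H.mul_inv_mul _ _ _ h3) rfl _ ha]
  have h5 := hV.isOpenEmbedding_subtypeVal.map_nhds_eq v₀
  rw [IsTranslate, show H.mul γ₂ γ₁ h = v₀.1 from rfl, ← h5]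
  exact key

end TopGroupoid

/-! ### Locality of characters and density of `Y` in `β_p Y`. -/

namespace FibreSpace

variable {X Y : Type*} [TopologicalSpace X] [TopologicalSpace Y]

/-- The element of `C₀(Y, p)` given by a bounded continuous function that vanishes over the
complement of a compact set. -/
noncomputable def c0Mk (F : FibreSpace X Y) (g : Y → ℂ) (hg : Continuous g) (C : ℝ)
    (hC : ∀ y, ‖g y‖ ≤ C) (K : Set X) (hK : IsCompact K) (h0 : ∀ y, F.p y ∉ K → g y = 0) :
    F.c0 :=
  ⟨BoundedContinuousFunction.ofNormedAddCommGroup g hg C hC, fun ε hε =>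
    ⟨K, hK, fun y hy => by
      simpa [h0 y hy] using hε.le⟩⟩

theorem beta_ext (F : FibreSpace X Y) {χ ψ : F.Beta} (h : ∀ g : F.c0, χ g = ψ g) : χ = ψ :=
  DFunLike.ext _ _ h

theorem isInducing_beta (F : FibreSpace X Y) :
    IsInducing fun (ψ : F.Beta) (g : F.c0) => ψ g :=
  ⟨by
    rw [instTopologicalSpaceSubtype]
    exact induced_compose⟩

variable [T2Space X] [LocallyCompactSpace X]

/-- The value of a character `χ` at `g ∈ C₀(Y, p)` depends only on `g` over a neighbourhood of
`p_β χ`. -/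
theorem beta_apply_congr (F : FibreSpace X Y) (χ : F.Beta) {g h : F.c0}
    (hgh : ∀ᶠ x in 𝓝 (F.betaProj χ), ∀ y, F.p y = x → (g : Y →ᵇ ℂ) y = (h : Y →ᵇ ℂ) y) :
    χ g = χ h := by
  obtain ⟨U, hUs, hU, hxU⟩ := mem_nhds_iff.1 hgh
  obtain ⟨f, hf1, hf0, -, -⟩ := exists_bump (isCompact_singleton (x := F.betaProj χ)) hU
    (by simpa using hxU)
  -- The cutoff `f` is invisible to `χ`, whose value at `F.pull f` is `f (p_β χ) = 1`.
  have h1 : g * F.pull f = h * F.pull f := by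
    refine Subtype.ext (BoundedContinuousFunction.ext fun y => ?_)
    change (g : Y →ᵇ ℂ) y * f (F.p y) = (h : Y →ᵇ ℂ) y * f (F.p y)
    by_cases hy : F.p y ∈ U
    · rw [hUs hy y rfl]
    · rw [hf0 _ hy, mul_zero, mul_zero]
  have h2 := congrArg χ h1
  rw [map_mul, map_mul, F.betaProj_spec, hf1 _ rfl, mul_one, mul_one] at h2
  exact h2

/-- There are elements of `C₀(X)` equal to `1` near a given point. -/
theorem exists_eventually_eq_one (x : X) : ∃ f : C₀(X, ℂ), ∀ᶠ z in 𝓝 x, f z = 1 := by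
  obtain ⟨K, hK, hx⟩ := exists_compact_mem_nhds x
  obtain ⟨f, hf, -⟩ := exists_bump hK isOpen_univ (subset_univ K)
  exact ⟨f, mem_of_superset hx hf⟩

/-- The canonical image of `Y` in `β_p Y` is dense. -/
theorem denseRange_toBeta (F : FibreSpace X Y) : DenseRange F.toBeta := by
  intro χ
  by_contra hcon
  have h1 : ∃ (t : Finset F.c0) (ε : ℝ), 0 < ε ∧
      ∀ y, ∃ g ∈ t, ε ≤ ‖(g : Y →ᵇ ℂ) y - χ g‖ := by
    by_contra! hne
    apply hcon
    rw [F.isInducing_beta.closure_eq_preimage_closure_image]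
    rw [mem_preimage, mem_closure_iff_nhds]
    intro W hW
    rw [nhds_pi, Filter.mem_pi'] at hW
    obtain ⟨t, V, hV, hVW⟩ := hW
    choose ε hε hεV using fun g => Metric.mem_nhds_iff.1 (hV g)
    obtain ⟨δ, hδε, hδ⟩ := ((t.eventually_all.2 fun g _ => Ioo_mem_nhdsGT (hε g)).and
      (self_mem_nhdsWithin (a := (0 : ℝ)) (s := Ioi 0))).exists
    obtain ⟨y, hy⟩ := hne t δ hδ
    refine ⟨_, hVW ?_, mem_image_of_mem _ (mem_range_self y)⟩
    intro g hg
    apply hεV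
    rw [Metric.mem_ball, dist_eq_norm]
    exact (hy g hg).trans (hδε g hg).2
  obtain ⟨t, ε, hε, ht⟩ := h1
  obtain ⟨f, hfc, hf⟩ := F.exists_pull_ne_zero χ
  -- The sum of squares `k` is bounded below by `ε²`, so `q = f/k` lies in the algebra. With `e = f
  -- ∘ p` this gives `e³ = (∑ (g - χ g) e · (g - χ g)* e) q`. Each first factor is in the kernel of
  -- `χ`, whereas `χ e ≠ 0`. The factors `e` are there because the algebra need not contain
  -- constants.
  let k : Y → ℝ := fun y => ∑ g ∈ t, ‖(g : Y →ᵇ ℂ) y - χ g‖ ^ 2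
  have hkε : ∀ y, ε ^ 2 ≤ k y := by
    intro y
    obtain ⟨g, hg, hgy⟩ := ht y
    calc ε ^ 2 ≤ ‖(g : Y →ᵇ ℂ) y - χ g‖ ^ 2 := by gcongr
      _ ≤ k y := Finset.single_le_sum (f := fun g : F.c0 => ‖(g : Y →ᵇ ℂ) y - χ g‖ ^ 2)
          (fun _ _ => by positivity) hg
  have hk0 : ∀ y, 0 < k y := fun y => (by positivity : 0 < ε ^ 2).trans_le (hkε y)
  have hkc : Continuous k := continuous_finsetSum _ fun g _ =>
    (((g : Y →ᵇ ℂ).continuous.sub continuous_const).norm.pow 2)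
  let q : F.c0 := F.c0Mk (fun y => f (F.p y) * ((k y)⁻¹ : ℝ))
    (((map_continuous f).comp F.continuous_p).mul
      (Complex.continuous_ofReal.comp (hkc.inv₀ fun y => (hk0 y).ne')))
    (‖f.toBCF‖ * (ε ^ 2)⁻¹) (fun y => by
      rw [norm_mul, Complex.norm_real, Real.norm_of_nonneg (inv_nonneg.2 (hk0 y).le)]
      gcongr
      · exact f.toBCF.norm_coe_le_norm _
      · exact hkε y)
    (tsupport f) hfc (fun y hy => by rw [image_eq_zero_of_notMem_tsupport hy, zero_mul])
  let e : F.c0 := F.pull f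
  let a : F.c0 → F.c0 := fun g => g * e - χ g • e
  let b : F.c0 → F.c0 := fun g => star g * e - starRingEnd ℂ (χ g) • e
  have ha : ∀ g, χ (a g) = 0 := fun g => by
    change χ (g * e - χ g • e) = 0
    rw [map_sub, map_mul, map_smul, smul_eq_mul, sub_self]
  have hfac : e * e * e = (∑ g ∈ t, a g * b g) * q := by
    refine Subtype.ext (BoundedContinuousFunction.ext fun y => ?_)
    have h2 : (((∑ g ∈ t, a g * b g) : F.c0) : Y →ᵇ ℂ) y
        = ∑ g ∈ t, ((a g * b g : F.c0) : Y →ᵇ ℂ) y :=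
      map_sum (⟨⟨fun g : F.c0 => (g : Y →ᵇ ℂ) y, rfl⟩, fun _ _ => rfl⟩ : F.c0 →+ ℂ) _ t
    have h3 : ∀ g ∈ t, ((a g * b g : F.c0) : Y →ᵇ ℂ) y
        = ((‖(g : Y →ᵇ ℂ) y - χ g‖ ^ 2 : ℝ) : ℂ) * (f (F.p y) * f (F.p y)) := by
      intro g _
      change ((g : Y →ᵇ ℂ) y * f (F.p y) - χ g * f (F.p y)) *
        (starRingEnd ℂ ((g : Y →ᵇ ℂ) y) * f (F.p y) - starRingEnd ℂ (χ g) * f (F.p y)) = _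
      rw [← Complex.normSq_eq_norm_sq, Complex.normSq_eq_conj_mul_self, map_sub]
      ring
    rw [Finset.sum_congr rfl h3, ← Finset.sum_mul, ← Complex.ofReal_sum] at h2
    change f (F.p y) * f (F.p y) * f (F.p y)
      = (((∑ g ∈ t, a g * b g) : F.c0) : Y →ᵇ ℂ) y * (f (F.p y) * ((k y)⁻¹ : ℝ))
    rw [h2, Complex.ofReal_inv]
    have h4 : (k y : ℂ) ≠ 0 := by exact_mod_cast (hk0 y).ne'
    change _ = (k y : ℂ) * _ * _
    field_simp
  have h3 : χ (e * e * e) = 0 := by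
    rw [hfac, map_mul, map_sum, Finset.sum_eq_zero fun g _ => by rw [map_mul, ha, zero_mul],
      zero_mul]
  rw [map_mul, map_mul] at h3
  simp only [mul_self_eq_zero, mul_eq_zero] at h3
  tauto

end FibreSpace

/-! ### The action on the Stone–Čech fibrewise compactification -/

namespace TopGroupoid

variable {G X : Type*} [TopologicalSpace G] [TopologicalSpace X]
  [T2Space G] [LocallyCompactSpace G] [T2Space X] [LocallyCompactSpace X]
  {H : TopGroupoid G X}

/-- Translates of elements of `C₀(G, r)` exist in `C₀(G, r)`. -/
theorem IsEtale.exists_isTranslate (hH : H.IsEtale) (γ : G) (g : H.rangeFibreSpace.c0) :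
    ∃ h : H.rangeFibreSpace.c0, H.IsTranslate γ (g : G →ᵇ ℂ) (h : G →ᵇ ℂ) ∧ ‖h‖ ≤ ‖g‖ := by
  obtain ⟨e, hγe, hes⟩ := hH.isLocalHomeomorph_s γ
  have hs : ∀ x ∈ e.target, H.s (e.symm x) = x := fun x hx => by
    rw [hes, e.right_inv hx]
  have hsγ : H.s γ ∈ e.target := by rw [hes]; exact e.map_source hγe
  obtain ⟨K, hK, hγK, hKe⟩ := exists_compact_subset e.open_target hsγ
  obtain ⟨φ, hφ1, hφc, hφe, hφ⟩ := exists_continuousMap_one_of_isCompact_subset_isOpen hK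
    e.open_target hKe
  classical
  -- On the chart, `e.symm` is a section of `s` through `γ`, so `e.symm (r a)` is the arrow near `γ`
  -- composable with `a`. The cutoff `φ` permits extension by zero.
  let h : G → ℂ := fun a =>
    if ha : H.r a ∈ e.target then
      φ (H.r a) * (g : G →ᵇ ℂ) (H.mul (e.symm (H.r a)) a (hs _ ha)) else 0
  have hh : ∀ a (ha : H.r a ∈ e.target),
      h a = φ (H.r a) * (g : G →ᵇ ℂ) (H.mul (e.symm (H.r a)) a (hs _ ha)) :=
    fun a ha => dif_pos ha
  have h0 : ∀ a, H.r a ∉ tsupport φ → h a = 0 := by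
    intro a ha
    by_cases hae : H.r a ∈ e.target
    · rw [hh a hae, image_eq_zero_of_notMem_tsupport ha, Complex.ofReal_zero, zero_mul]
    · exact dif_neg hae
  have hbound : ∀ a, ‖h a‖ ≤ ‖g‖ := by
    intro a
    by_cases hae : H.r a ∈ e.target
    · rw [hh a hae, norm_mul, Complex.norm_real, Real.norm_of_nonneg (hφ _).1]
      calc _ ≤ 1 * ‖g‖ := by
            gcongr
            · exact (hφ _).2
            · exact (g : G →ᵇ ℂ).norm_coe_le_norm _
        _ = ‖g‖ := one_mul _
    · rw [show h a = 0 from dif_neg hae, norm_zero]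
      exact norm_nonneg _
  have hcont : Continuous h := by
    have hopen : IsOpen (H.r ⁻¹' e.target) := e.open_target.preimage H.continuous_r
    have hon : ContinuousOn h (H.r ⁻¹' e.target) := by
      rw [continuousOn_iff_continuous_domRestrict]
      have e1 : (H.r ⁻¹' e.target).domRestrict h = fun a => φ (H.r a.1) *
          (g : G →ᵇ ℂ) (H.mul (e.symm (H.r a.1)) a.1 (hs _ a.2)) := funext fun a => hh a.1 a.2
      rw [e1]
      have hr : Continuous fun a : H.r ⁻¹' e.target => H.r a.1 :=
        H.continuous_r.comp continuous_subtype_val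
      refine (Complex.continuous_ofReal.comp (φ.continuous.comp hr)).mul
        ((g : G →ᵇ ℂ).continuous.comp (H.continuous_mul_of _ _ _ ?_ continuous_subtype_val))
      exact e.continuousOn_symm.comp_continuous hr fun a => a.2
    rw [continuous_iff_continuousAt]
    intro a
    by_cases ha : H.r a ∈ tsupport φ
    · exact hon.continuousAt (hopen.mem_nhds (hφe ha))
    · have h1 : h =ᶠ[𝓝 a] fun _ => 0 := by
        filter_upwards [((isClosed_tsupport φ).isOpen_compl.preimage
          H.continuous_r).mem_nhds ha] with b hb
        exact h0 b hb
      exact continuousAt_const.congr h1.symm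
  refine ⟨H.rangeFibreSpace.c0Mk h hcont ‖g‖ hbound (tsupport φ) hφc h0, ?_,
    (BoundedContinuousFunction.norm_le (norm_nonneg g)).2 hbound⟩
  -- For `γ'` in the chart with source in `K`, the cutoff is `1` and the section returns `γ'`
  -- itself, so the same `h` works for every such `γ'`.
  have h1 : H.s ⁻¹' interior K ∈ 𝓝 γ :=
    (isOpen_interior.preimage H.continuous_s).mem_nhds hγK
  filter_upwards [h1, e.open_source.mem_nhds hγe] with γ' h2 h3 a ha
  have h4 : H.r a ∈ K := ha ▸ interior_subset h2
  change h a = _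
  rw [hh a (hKe h4), hφ1 h4, Pi.one_apply, Complex.ofReal_one, one_mul]
  have h5 : e.symm (H.r a) = γ' := by rw [← ha, hes, e.left_inv h3]
  rw [H.mul_congr h5 rfl _ ha]

/-- The translate of a character. -/
theorem IsEtale.exists_beta_translate (hH : H.IsEtale) (γ : G) (χ : H.rangeFibreSpace.Beta)
    (hγ : H.s γ = H.rangeFibreSpace.betaProj χ) :
    ∃ ψ : H.rangeFibreSpace.Beta, ∀ g h : H.rangeFibreSpace.c0,
      H.IsTranslate γ (g : G →ᵇ ℂ) (h : G →ᵇ ℂ) → ψ g = χ h := by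
  -- `T` is an arbitrary choice and need not be linear or multiplicative; `χ ∘ T` is both, because
  -- sums, multiples and products of translates are again translates and `key` removes the choice.
  choose T hT hTn using hH.exists_isTranslate γ
  have key : ∀ g h : H.rangeFibreSpace.c0,
      H.IsTranslate γ (g : G →ᵇ ℂ) (h : G →ᵇ ℂ) → χ (T g) = χ h := by
    intro g h hgh
    refine H.rangeFibreSpace.beta_apply_congr χ ?_
    rw [← hγ]
    exact (hT g).eventually_eq hH hgh
  let L : H.rangeFibreSpace.c0 →ₗ[ℂ] ℂ :=
    { toFun := fun g => χ (T g)
      map_add' := fun a b => by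
        rw [← map_add]
        refine key _ _ ?_
        filter_upwards [hT a, hT b] with γ' h1 h2 c hc
        exact congrArg₂ (· + ·) (h1 c hc) (h2 c hc)
      map_smul' := fun z a => by
        rw [RingHom.id_apply, ← map_smul]
        refine key _ _ ?_
        filter_upwards [hT a] with γ' h1 c hc
        exact congrArg (z • ·) (h1 c hc) }
  let T' : StrongDual ℂ H.rangeFibreSpace.c0 := WeakDual.toStrongDual χ.1
  let L' : H.rangeFibreSpace.c0 →L[ℂ] ℂ := L.mkContinuous ‖T'‖ fun g =>
    (T'.le_opNorm (T g)).trans (by gcongr; exact hTn g)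
  refine ⟨⟨L', fun h0 => ?_, fun a b => ?_⟩, key⟩
  -- The functional is nonzero: as `r(γ'a) = r(γ')`, a function of `r` equal to `1` near `r γ`
  -- translates to one equal to `1` over a neighbourhood of `s γ`.
  · obtain ⟨f, hf⟩ := FibreSpace.exists_eventually_eq_one (H.r γ)
    obtain ⟨f', hf'⟩ := FibreSpace.exists_eventually_eq_one (H.s γ)
    have h1 : χ (T (H.rangeFibreSpace.pull f)) = χ (H.rangeFibreSpace.pull f') := by
      refine H.rangeFibreSpace.beta_apply_congr χ ?_
      rw [← hγ]
      have h2 := hH.isOpenMap_s.image_mem_nhds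
        ((hT (H.rangeFibreSpace.pull f)).and (H.continuous_r.continuousAt.eventually hf))
      filter_upwards [h2, hf']
      rintro x ⟨γ', ⟨h3, h4⟩, rfl⟩ h5 a ha
      rw [h3 a ha.symm]
      change f (H.r _) = f' (H.r a)
      exact (congrArg f (H.r_mul γ' a ha.symm)).trans
        (h4.trans (h5.symm.trans (congrArg f' ha.symm)))
    rw [H.rangeFibreSpace.betaProj_spec, ← hγ, hf'.self_of_nhds] at h1
    exact one_ne_zero (h1.symm.trans (DFunLike.congr_fun h0 (H.rangeFibreSpace.pull f)))
  · change χ (T (a * b)) = χ (T a) * χ (T b)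
    rw [← map_mul]
    refine key _ _ ?_
    filter_upwards [hT a, hT b] with γ' h1 h2 c hc
    exact congrArg₂ (· * ·) (h1 c hc) (h2 c hc)

/-- The translate `γ χ` of a character `χ` with `s γ = r_β χ`: its value at `g` is the value of `χ`
at any translate of `g` by `γ`. -/
noncomputable def IsEtale.betaAct (hH : H.IsEtale) (γ : G) (χ : H.rangeFibreSpace.Beta)
    (hγ : H.s γ = H.rangeFibreSpace.betaProj χ) : H.rangeFibreSpace.Beta :=
  (hH.exists_beta_translate γ χ hγ).choose

theorem IsEtale.betaAct_apply (hH : H.IsEtale) (γ : G) (χ : H.rangeFibreSpace.Beta)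
    (hγ : H.s γ = H.rangeFibreSpace.betaProj χ) {g h : H.rangeFibreSpace.c0}
    (hgh : H.IsTranslate γ (g : G →ᵇ ℂ) (h : G →ᵇ ℂ)) : hH.betaAct γ χ hγ g = χ h :=
  (hH.exists_beta_translate γ χ hγ).choose_spec g h hgh

end TopGroupoid

/-! ### Topology of `β_p Y`: continuity criterion, norm bound, fibrewise compactness. -/

namespace FibreSpace

variable {X Y : Type*} [TopologicalSpace X] [TopologicalSpace Y]

theorem continuous_beta_iff (F : FibreSpace X Y) {Z : Type*} [TopologicalSpace Z]
    {f : Z → F.Beta} : Continuous f ↔ ∀ g : F.c0, Continuous fun z => f z g := by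
  rw [F.isInducing_beta.continuous_iff, continuous_pi_iff]
  rfl

/-- Multiplicativity gives `|χ(a)|² = |χ(a²)| ≤ ‖χ‖ ‖a‖²`, hence `‖χ‖ ≤ √‖χ‖`. -/
theorem norm_beta_le_one (F : FibreSpace X Y) (χ : F.Beta) :
    ‖WeakDual.toStrongDual χ.1‖ ≤ 1 := by
  set T : StrongDual ℂ F.c0 := WeakDual.toStrongDual χ.1
  have hmul : ∀ a : F.c0, T (a * a) = T a * T a := fun a => χ.2.2 a a
  have hsq : ‖T‖ ≤ √‖T‖ := by
    refine T.opNorm_le_bound (Real.sqrt_nonneg _) fun a => ?_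
    have h1 : ‖T a‖ ^ 2 ≤ ‖T‖ * ‖a‖ ^ 2 := by
      calc ‖T a‖ ^ 2 = ‖T (a * a)‖ := by rw [hmul, norm_mul, sq]
        _ ≤ ‖T‖ * ‖a * a‖ := T.le_opNorm _
        _ ≤ ‖T‖ * (‖a‖ * ‖a‖) := by gcongr; exact norm_mul_le a a
        _ = ‖T‖ * ‖a‖ ^ 2 := by ring
    refine abs_le_of_sq_le_sq' ?_ (by positivity) |>.2
    rwa [mul_pow, Real.sq_sqrt T.opNorm_nonneg]
  by_contra! hlt
  have h2 : √‖T‖ * √‖T‖ = ‖T‖ := Real.mul_self_sqrt T.opNorm_nonneg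
  have h3 : 1 < √‖T‖ := by rw [Real.lt_sqrt (by norm_num)]; simpa using hlt
  nlinarith

variable [T2Space X] [LocallyCompactSpace X]

theorem continuous_toBeta (F : FibreSpace X Y) : Continuous F.toBeta :=
  F.continuous_beta_iff.2 fun g => (g : Y →ᵇ ℂ).continuous

/-- `β_p Y` is fibrewise compact. -/
theorem isFibrewiseCompact_beta (F : FibreSpace X Y) : F.beta.IsFibrewiseCompact := by
  intro K hK
  obtain ⟨f, hf, -⟩ := exists_bump hK isOpen_univ (subset_univ K)
  -- The condition `χ (F.pull f) = 1` is closed and excludes the zero functional, so these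
  -- characters form a weak-* closed subset of the unit ball.
  have hT : IsCompact {χ : F.Beta | χ (F.pull f) = 1} := by
    rw [Subtype.isCompact_iff]
    refine (WeakDual.isCompact_closedBall (0 : StrongDual ℂ F.c0) 1).of_isClosed_subset ?_ ?_
    · have h1 : Subtype.val '' {χ : F.Beta | χ (F.pull f) = 1} =
          {φ : WeakDual ℂ F.c0 | φ (F.pull f) = 1} ∩ ⋂ (a : F.c0) (b : F.c0),
            {φ : WeakDual ℂ F.c0 | φ (a * b) = φ a * φ b} := by
        ext φ
        simp only [mem_image, mem_inter_iff, mem_iInter]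
        constructor
        · rintro ⟨χ, hχ, rfl⟩
          exact ⟨hχ, χ.2.2⟩
        · rintro ⟨h1, h2⟩
          refine ⟨⟨φ, fun h0 => ?_, h2⟩, h1, rfl⟩
          exact zero_ne_one ((DFunLike.congr_fun h0 (F.pull f)).symm.trans h1)
      rw [h1]
      refine (isClosed_eq (WeakDual.eval_continuous _) continuous_const).inter
        (isClosed_iInter fun a => isClosed_iInter fun b => ?_)
      exact isClosed_eq (WeakDual.eval_continuous _)
        ((WeakDual.eval_continuous _).mul (WeakDual.eval_continuous _))
    · rintro _ ⟨χ, -, rfl⟩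
      simpa using F.norm_beta_le_one χ
  refine hT.of_isClosed_subset (hK.isClosed.preimage F.continuous_betaProj) fun χ hχ => ?_
  exact (F.betaProj_spec χ f).trans (hf _ hχ)

end FibreSpace

/-! ### The `G`-space `β_r G` and its uniqueness. -/

namespace TopGroupoid

variable {G X : Type*} [TopologicalSpace G] [TopologicalSpace X]
  [T2Space G] [LocallyCompactSpace G] [T2Space X] [LocallyCompactSpace X]
  {H : TopGroupoid G X}

theorem IsEtale.betaAct_toBeta (hH : H.IsEtale) (γ a : G)
    (hγ : H.s γ = H.rangeFibreSpace.betaProj (H.rangeFibreSpace.toBeta a)) (h : H.s γ = H.r a) :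
    hH.betaAct γ (H.rangeFibreSpace.toBeta a) hγ = H.rangeFibreSpace.toBeta (H.mul γ a h) := by
  refine H.rangeFibreSpace.beta_ext fun g => ?_
  obtain ⟨k, hk, -⟩ := hH.exists_isTranslate γ g
  rw [hH.betaAct_apply _ _ _ hk]
  exact hk.self_of_nhds a h

/-- A translate `k` of `g` by `γ` is also a translate by every nearby `γ'`, so near `(γ, χ)` the map
`(γ', χ') ↦ (γ'χ')(g)` is just `χ' ↦ χ' k`. -/
theorem IsEtale.continuous_betaAct (hH : H.IsEtale) :
    Continuous fun q : {q : G × H.rangeFibreSpace.Beta //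
      H.s q.1 = H.rangeFibreSpace.betaProj q.2} => hH.betaAct q.1.1 q.1.2 q.2 := by
  rw [FibreSpace.continuous_beta_iff]
  intro g
  rw [continuous_iff_continuousAt]
  intro q
  obtain ⟨k, hk, -⟩ := hH.exists_isTranslate q.1.1 g
  have h1 : Continuous fun q : {q : G × H.rangeFibreSpace.Beta //
      H.s q.1 = H.rangeFibreSpace.betaProj q.2} => q.1.2 k :=
    (H.rangeFibreSpace.continuous_beta_apply k).comp
      (continuous_snd.comp continuous_subtype_val)
  refine h1.continuousAt.congr ?_
  have h2 : Continuous fun q : {q : G × H.rangeFibreSpace.Beta //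
      H.s q.1 = H.rangeFibreSpace.betaProj q.2} => q.1.1 :=
    continuous_fst.comp continuous_subtype_val
  filter_upwards [h2.continuousAt.eventually hk.eventually] with q' hq'
  exact (hH.betaAct_apply _ _ _ hq').symm

/-- Continuous maps into a Hausdorff space on the fibred product of `G` and `β_r G` are equal if
they agree on the image of the composable pairs. -/
theorem IsEtale.eq_of_eq_toBeta (hH : H.IsEtale) {Z : Type*} [TopologicalSpace Z] [T2Space Z]
    {f f' : {q : G × H.rangeFibreSpace.Beta // H.s q.1 = H.rangeFibreSpace.betaProj q.2} → Z}
    (hf : Continuous f) (hf' : Continuous f')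
    (h : ∀ (γ a : G) (e : H.s γ = H.r a),
      f ⟨(γ, H.rangeFibreSpace.toBeta a), e.trans (H.rangeFibreSpace.betaProj_toBeta a).symm⟩ =
        f' ⟨(γ, H.rangeFibreSpace.toBeta a), e.trans (H.rangeFibreSpace.betaProj_toBeta a).symm⟩) :
    f = f' := by
  funext q
  by_contra hne
  have ho : IsOpen {q | f q ≠ f' q} := isOpen_ne_fun hf hf'
  obtain ⟨W, hW, hWe⟩ := isOpen_induced_iff.1 ho
  have hq : q.1 ∈ W := by
    have : q ∈ Subtype.val ⁻¹' W := hWe ▸ hne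
    exact this
  obtain ⟨U, V, hU, hV, hqU, hqV, hUV⟩ := isOpen_prod_iff.1 hW q.1.1 q.1.2 hq
  -- Openness of `s` makes this set open; density puts some `ι(a)` in it, and then `r a = s γ` for
  -- some `γ ∈ U`, a composable pair inside `U × V`.
  have hV' : IsOpen (V ∩ H.rangeFibreSpace.betaProj ⁻¹' (H.s '' U)) :=
    hV.inter ((hH.isOpenMap_s U hU).preimage H.rangeFibreSpace.continuous_betaProj)
  obtain ⟨a, haV, γ, hγU, hγa⟩ := H.rangeFibreSpace.denseRange_toBeta.exists_mem_open hV'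
    ⟨q.1.2, hqV, q.1.1, hqU, q.2⟩
  rw [H.rangeFibreSpace.betaProj_toBeta] at hγa
  have h1 : (⟨(γ, H.rangeFibreSpace.toBeta a),
      hγa.trans (H.rangeFibreSpace.betaProj_toBeta a).symm⟩ :
      {q : G × H.rangeFibreSpace.Beta // H.s q.1 = H.rangeFibreSpace.betaProj q.2})
      ∈ Subtype.val ⁻¹' W := hUV ⟨hγU, haV⟩
  rw [hWe] at h1
  exact h1 (h γ a hγa)

theorem IsEtale.betaProj_betaAct (hH : H.IsEtale) (γ : G) (χ : H.rangeFibreSpace.Beta)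
    (hγ : H.s γ = H.rangeFibreSpace.betaProj χ) :
    H.rangeFibreSpace.betaProj (hH.betaAct γ χ hγ) = H.r γ := by
  refine congrFun (hH.eq_of_eq_toBeta
    (H.rangeFibreSpace.continuous_betaProj.comp hH.continuous_betaAct)
    (H.continuous_r.comp (continuous_fst.comp continuous_subtype_val)) fun γ a e => ?_)
    ⟨(γ, χ), hγ⟩
  change H.rangeFibreSpace.betaProj (hH.betaAct γ (H.rangeFibreSpace.toBeta a) _) = H.r γ
  rw [hH.betaAct_toBeta γ a _ e, H.rangeFibreSpace.betaProj_toBeta]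
  exact H.r_mul _ _ _

/-- The action of an étale groupoid on `β_r G`. -/
noncomputable def IsEtale.betaGSpace (hH : H.IsEtale) : GSpace H H.rangeFibreSpace.beta where
  act := hH.betaAct
  p_act := hH.betaProj_betaAct
  unit_act χ := by
    refine H.rangeFibreSpace.beta_ext fun g => ?_
    -- Arrows near a unit are units, so `g` is its own translate there.
    refine hH.betaAct_apply _ _ _ ?_
    filter_upwards [hH.eventually_eq_unit (H.rangeFibreSpace.beta.p χ)] with γ hγ a ha
    have h1 : γ = H.unit (H.r a) := by
      rw [← ha]
      exact hγ.trans (congrArg H.unit ((H.s_unit _).symm.trans (congrArg H.s hγ.symm)))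
    rw [H.mul_congr h1 rfl ha (H.s_unit _), H.unit_mul]
  mul_act γ₂ γ₁ χ h h₂ := by
    refine H.rangeFibreSpace.beta_ext fun g => ?_
    obtain ⟨k, hk, -⟩ := hH.exists_isTranslate γ₂ g
    obtain ⟨l, hl, -⟩ := hH.exists_isTranslate γ₁ k
    exact (hH.betaAct_apply _ χ _ (hH.isTranslate_mul h₂ hk hl)).trans
      ((hH.betaAct_apply γ₁ χ _ hl).symm.trans (hH.betaAct_apply γ₂ _ _ hk).symm)
  continuous_act := hH.continuous_betaAct

theorem IsEtale.extends_betaGSpace (hH : H.IsEtale) :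
    hH.betaGSpace.Extends H.leftTranslation :=
  fun γ a h => hH.betaAct_toBeta γ a (h.trans (H.rangeFibreSpace.betaProj_toBeta a).symm) h

theorem IsEtale.eq_of_extends (hH : H.IsEtale) {B B' : GSpace H H.rangeFibreSpace.beta}
    (hB : B.Extends H.leftTranslation) (hB' : B'.Extends H.leftTranslation) : B = B' := by
  have h1 := hH.eq_of_eq_toBeta B.continuous_act B'.continuous_act fun γ a e =>
    (hB γ a e).trans (hB' γ a e).symm
  have h2 : B.act = B'.act := by
    funext γ χ h
    exact congrFun h1 ⟨(γ, χ), h⟩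
  cases B; cases B'
  cases h2
  rfl

end TopGroupoid

/-! ### Extension of fibre maps to the Stone–Čech fibrewise compactification -/

namespace FibreSpace

variable {X Y Z : Type*} [TopologicalSpace X] [TopologicalSpace Y] [TopologicalSpace Z]

/-- A locally compact Hausdorff space as a fibre space over itself. -/
def idSpace (Y : Type*) [TopologicalSpace Y] [T2Space Y] [LocallyCompactSpace Y] :
    FibreSpace Y Y where
  p := id
  continuous_p := continuous_id
  surjective_p := Function.surjective_id
  t2 := inferInstance
  locallyCompact := inferInstance

variable [T2Space X] [LocallyCompactSpace X] [T2Space Y] [LocallyCompactSpace Y]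

/-- Composition with a fibre map `f`, from `C₀(Y)` to `C₀(Z, p)`. -/
noncomputable def compFibreMap (F : FibreSpace X Z) (E : FibreSpace X Y) {f : Z → Y}
    (hf : Continuous f) (hfp : ∀ z, E.p (f z) = F.p z) (g : (idSpace Y).c0) : F.c0 :=
  ⟨(g : Y →ᵇ ℂ).compContinuous ⟨f, hf⟩, fun ε hε => by
    obtain ⟨K, hK, h⟩ := g.2 ε hε
    exact ⟨E.p '' K, hK.image E.continuous_p, fun z hz => h (f z) fun hk =>
      hz ⟨f z, hk, hfp z⟩⟩⟩

/-- The map `β_p Z → β Y` induced by a fibre map `f : Z → Y` into a fibrewise compact space. -/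
noncomputable def betaMap (F : FibreSpace X Z) (E : FibreSpace X Y)
    (hE : E.IsFibrewiseCompact) {f : Z → Y} (hf : Continuous f) (hfp : ∀ z, E.p (f z) = F.p z)
    (χ : F.Beta) : (idSpace Y).Beta :=
  ⟨LinearMap.mkContinuous
    { toFun := fun g => χ (F.compFibreMap E hf hfp g)
      map_add' := fun a b => map_add χ (F.compFibreMap E hf hfp a) (F.compFibreMap E hf hfp b)
      map_smul' := fun c a => map_smul χ c (F.compFibreMap E hf hfp a) } 1 fun g => by
      refine ((WeakDual.toStrongDual χ.1).le_opNorm _).trans ?_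
      gcongr
      · exact F.norm_beta_le_one χ
      · exact (BoundedContinuousFunction.norm_le (norm_nonneg g)).2 fun z =>
          (g : Y →ᵇ ℂ).norm_coe_le_norm (f z), by
    refine ⟨fun h0 => ?_, fun a b =>
      map_mul χ (F.compFibreMap E hf hfp a) (F.compFibreMap E hf hfp b)⟩
    -- Fibrewise compactness enters here: it makes `k ∘ E.p` compactly supported on `Y`, hence an
    -- element of `C₀(Y)` on which the functional is nonzero.
    obtain ⟨k, hkc, hk⟩ := F.exists_pull_ne_zero χ
    let g : (idSpace Y).c0 := (idSpace Y).c0Mk (fun y => k (E.p y))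
      ((map_continuous k).comp E.continuous_p) ‖k.toBCF‖
      (fun y => k.toBCF.norm_coe_le_norm _) (E.p ⁻¹' tsupport k) (hE _ hkc)
      (fun y hy => image_eq_zero_of_notMem_tsupport hy)
    have h1 : F.compFibreMap E hf hfp g = F.pull k :=
      Subtype.ext (BoundedContinuousFunction.ext fun z => congrArg k (hfp z))
    exact hk (h1 ▸ DFunLike.congr_fun h0 g)⟩

/-- The extension to `β_p Z` of a fibre map `f : Z → Y` into a fibrewise compact space. -/
noncomputable def betaLift (F : FibreSpace X Z) (E : FibreSpace X Y)
    (hE : E.IsFibrewiseCompact) {f : Z → Y} (hf : Continuous f) (hfp : ∀ z, E.p (f z) = F.p z)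
    (χ : F.Beta) : Y :=
  -- For the identity fibration, `betaProj` is Gelfand duality for `C₀(Y)`: it returns the point of
  -- `Y` at which the character evaluates.
  (idSpace Y).betaProj (F.betaMap E hE hf hfp χ)

variable (F : FibreSpace X Z) (E : FibreSpace X Y) (hE : E.IsFibrewiseCompact) {f : Z → Y}
  (hf : Continuous f) (hfp : ∀ z, E.p (f z) = F.p z)

theorem continuous_betaLift : Continuous (F.betaLift E hE hf hfp) :=
  (idSpace Y).continuous_betaProj.comp
    ((idSpace Y).continuous_beta_iff.2 fun _ => F.continuous_beta_apply _)

theorem betaLift_toBeta (z : Z) : F.betaLift E hE hf hfp (F.toBeta z) = f z :=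
  ((idSpace Y).existsUnique_proj (F.betaMap E hE hf hfp (F.toBeta z))).unique
    ((idSpace Y).betaProj_spec _) fun _ => rfl

theorem p_betaLift (χ : F.Beta) : E.p (F.betaLift E hE hf hfp χ) = F.betaProj χ := by
  refine congrFun (F.denseRange_toBeta.equalizer
    (E.continuous_p.comp (F.continuous_betaLift E hE hf hfp)) F.continuous_betaProj ?_) χ
  funext z
  change E.p (F.betaLift E hE hf hfp (F.toBeta z)) = F.betaProj (F.toBeta z)
  rw [betaLift_toBeta, betaProj_toBeta, hfp]

end FibreSpace

/-- A map between `G`-spaces is equivariant. -/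
def GSpace.IsEquivariant {G X Y Z : Type*} [TopologicalSpace G] [TopologicalSpace X]
    [TopologicalSpace Y] [TopologicalSpace Z] {H : TopGroupoid G X} {E : FibreSpace X Y}
    {F : FibreSpace X Z} (A : GSpace H E) (B : GSpace H F) (f : Z → Y)
    (hfp : ∀ z, E.p (f z) = F.p z) : Prop :=
  ∀ γ z (h : H.s γ = F.p z), f (B.act γ z h) = A.act γ (f z) (h.trans (hfp z).symm)

namespace TopGroupoid

variable {G X Y : Type*} [TopologicalSpace G] [TopologicalSpace X] [TopologicalSpace Y]
  [T2Space G] [LocallyCompactSpace G] [T2Space X] [LocallyCompactSpace X]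
  {H : TopGroupoid G X}

/-- A fibrewise compact `G`-space with a continuous section receives an equivariant map from
`β_r G`. -/
theorem IsEtale.exists_equivariant (hH : H.IsEtale) {E : FibreSpace X Y} (A : GSpace H E)
    (hE : E.IsFibrewiseCompact) {σ : X → Y} (hσ : Continuous σ) (hσp : ∀ x, E.p (σ x) = x) :
    ∃ (f : H.rangeFibreSpace.Beta → Y) (hfp : ∀ χ, E.p (f χ) = H.rangeFibreSpace.beta.p χ),
      Continuous f ∧ A.IsEquivariant hH.betaGSpace f hfp := by
  have := E.t2
  have := E.locallyCompact
  -- The orbit map of the section; it is equivariant because `s(γa) = s(a)`.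
  let f : G → Y := fun a => A.act a (σ (H.s a)) (hσp _).symm
  have hf : Continuous f := A.continuous_act_of _ _ _ continuous_id (hσ.comp H.continuous_s)
  have hfp : ∀ a, E.p (f a) = H.rangeFibreSpace.p a := fun a => A.p_act _ _ _
  have hc := H.rangeFibreSpace.continuous_betaLift E hE hf hfp
  have hp := H.rangeFibreSpace.p_betaLift E hE hf hfp
  have hc2 : Continuous fun q : {q : G × H.rangeFibreSpace.Beta //
      H.s q.1 = H.rangeFibreSpace.betaProj q.2} => H.rangeFibreSpace.betaLift E hE hf hfp q.1.2 :=
    hc.comp (continuous_snd.comp continuous_subtype_val)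
  refine ⟨H.rangeFibreSpace.betaLift E hE hf hfp, hp, hc, fun γ χ h => ?_⟩
  refine congrFun (hH.eq_of_eq_toBeta (hc.comp hH.continuous_betaAct)
    (A.continuous_act_of (fun q => q.1.1) (fun q => H.rangeFibreSpace.betaLift E hE hf hfp q.1.2)
      (fun q => q.2.trans (hp _).symm) (continuous_fst.comp continuous_subtype_val)
      hc2) fun γ a e => ?_) ⟨(γ, χ), h⟩
  have h1 := H.rangeFibreSpace.betaLift_toBeta E hE hf hfp
  have h2 : H.s γ = E.p (f a) := e.trans (hfp a).symm
  refine ((congrArg _ (hH.betaAct_toBeta γ a _ e)).trans (h1 _)).trans ?_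
  refine Eq.trans ?_ (A.act_congr rfl (h1 a).symm h2 _)
  have h3 : H.s a = E.p (σ (H.s a)) := (hσp _).symm
  exact (A.act_congr rfl (congrArg σ (H.s_mul γ a e)) _ ((H.s_mul γ a e).trans h3)).trans
    (A.mul_act γ a _ h3 e)

end TopGroupoid

/-! ### Amenability passes to spaces over an amenable space -/

/-- Total variation is invariant under measurable equivalences. -/
theorem totalVariation_sub_map {α β : Type*} [MeasurableSpace α] [MeasurableSpace β]
    (e : α ≃ᵐ β) {μ ν : Measure α} {μ' ν' : Measure β} [IsFiniteMeasure μ] [IsFiniteMeasure ν]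
    [IsFiniteMeasure μ'] [IsFiniteMeasure ν'] (hμ : μ' = μ.map e) (hν : ν' = ν.map e) :
    (μ'.toSignedMeasure - ν'.toSignedMeasure).totalVariation =
      (μ.toSignedMeasure - ν.toSignedMeasure).totalVariation.map e := by
  set j := (μ.toSignedMeasure - ν.toSignedMeasure).toJordanDecomposition with hj
  have hjs : j.toSignedMeasure = μ.toSignedMeasure - ν.toSignedMeasure :=
    SignedMeasure.toSignedMeasure_toJordanDecomposition _
  -- The transported Jordan parts stay mutually singular, so uniqueness makes them the Jordan
  -- decomposition of the transported difference.
  let j' : JordanDecomposition β :=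
    { posPart := j.posPart.map e
      negPart := j.negPart.map e
      mutuallySingular := by
        obtain ⟨s, hs, h1, h2⟩ := j.mutuallySingular
        refine ⟨e.symm ⁻¹' s, e.symm.measurable hs, ?_, ?_⟩
        · rw [e.map_apply, ← preimage_comp, e.symm_comp_self, preimage_id]
          exact h1
        · rw [e.map_apply, ← preimage_compl, ← preimage_comp, e.symm_comp_self, preimage_id]
          exact h2 }
  have hj' : μ'.toSignedMeasure - ν'.toSignedMeasure = j'.toSignedMeasure := by
    subst hμ hν
    ext s hs
    have h1 := congrArg (fun v : SignedMeasure α => v (e ⁻¹' s)) hjs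
    have hs' : MeasurableSet (e ⁻¹' s) := e.measurable hs
    simp only [JordanDecomposition.toSignedMeasure, _root_.sub_apply,
      Measure.toSignedMeasure_apply_measurable hs'] at h1
    simp only [JordanDecomposition.toSignedMeasure, _root_.sub_apply,
      Measure.toSignedMeasure_apply_measurable hs]
    simp only [measureReal_def, e.map_apply, j'] at h1 ⊢
    exact h1.symm
  rw [SignedMeasure.totalVariation, SignedMeasure.totalVariation,
    SignedMeasure.toJordanDecomposition_eq hj', ← hj, Measure.map_add _ _ e.measurable]

/-! ### Test functions on the fibres of the range map. -/

namespace TopGroupoid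

/-- In an étale groupoid, compactly supported functions on a fibre of the range map extend to
continuous compactly supported functions. -/
theorem IsEtale.exists_extension {G X : Type*} [TopologicalSpace G] [TopologicalSpace X]
    [T2Space G] [LocallyCompactSpace G] [T2Space X] {H : TopGroupoid G X} (hH : H.IsEtale) (x : X)
    (φ : G → ℂ) {K : Set G} (hK : IsCompact K) (hφ : ∀ a, a ∉ K → φ a = 0) :
    ∃ k : G → ℂ, Continuous k ∧ HasCompactSupport k ∧ ∀ a, H.r a = x → k a = φ a := by
  have hU : ∀ a : G, ∃ U : Set G, IsOpen U ∧ a ∈ U ∧ InjOn H.r U := fun a => by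
    obtain ⟨e, hae, her⟩ := hH a
    exact ⟨e.source, e.open_source, hae, her ▸ e.injOn⟩
  choose U hUo haU hUi using hU
  have hK' : IsCompact (K ∩ H.r ⁻¹' {x}) :=
    hK.inter_right (isClosed_singleton.preimage H.continuous_r)
  obtain ⟨t, htK, ht⟩ := hK'.elim_nhds_subcover U fun a _ => (hUo a).mem_nhds (haU a)
  choose b hb1 hbc hbU hb using fun a : G =>
    exists_continuousMap_one_of_isCompact_subset_isOpen (isCompact_singleton (x := a)) (hUo a)
      (singleton_subset_iff.2 (haU a))
  classical
  -- Each `U a` meets the fibre over `x` only at its centre `a`, so `K` meets that fibre in the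
  -- finite set `t`. There the bumps `b a` are indicators of points, and a weighted sum of them
  -- interpolates `φ`, whether or not `φ` is continuous on `G`.
  have hbt : ∀ a ∈ t, ∀ c, H.r c = x → b a c = if c = a then 1 else 0 := by
    intro a ha c hc
    split_ifs with h
    · rw [h]; exact hb1 a rfl
    · refine image_eq_zero_of_notMem_tsupport fun hcs => h ?_
      exact hUi a (hbU a hcs) (haU a) (hc.trans (htK a ha).2.symm)
  refine ⟨fun c => ∑ a ∈ t, φ a * (b a c : ℂ), ?_, ?_, fun c hc => ?_⟩
  · exact continuous_finsetSum _ fun a _ =>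
      continuous_const.mul (Complex.continuous_ofReal.comp (b a).continuous)
  · refine HasCompactSupport.intro (t.isCompact_biUnion fun a _ => hbc a) fun c hc => ?_
    refine Finset.sum_eq_zero fun a ha => ?_
    rw [image_eq_zero_of_notMem_tsupport fun h => hc (mem_biUnion ha h), Complex.ofReal_zero,
      mul_zero]
  · change ∑ a ∈ t, φ a * (b a c : ℂ) = φ c
    rw [Finset.sum_congr rfl fun a ha => by rw [hbt a ha c hc]]
    by_cases hct : c ∈ t
    · rw [Finset.sum_eq_single_of_mem c hct fun a _ hac => by simp [hac.symm]]
      simp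
    · have hcK : c ∉ K := fun hcK => by
        obtain ⟨a, ha, hca⟩ := mem_iUnion₂.1 (ht ⟨hcK, hc⟩)
        exact hct (hUi a hca (haU a) (hc.trans (htK a ha).2.symm) ▸ ha)
      rw [hφ c hcK]
      refine Finset.sum_eq_zero fun a ha => ?_
      have hca : c ≠ a := fun h => hct (h ▸ ha)
      simp [hca]

theorem ProbFamily.integrable {G X Z : Type*} [TopologicalSpace G] [TopologicalSpace X]
    [TopologicalSpace Z] {H : TopGroupoid G X} (m : H.ProbFamily) (x : X) (φ : C_c(Z, ℂ))
    {u : H.Fibre x → Z} (hu : Continuous u) : Integrable (fun g => φ (u g)) (m.meas x) := by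
  obtain ⟨C, hC⟩ := φ.hasCompactSupport.exists_bound_of_continuous (map_continuous φ)
  exact Integrable.of_bound ((map_continuous φ).comp hu).aestronglyMeasurable C
    (Eventually.of_forall fun g => hC _)

end TopGroupoid

/-! ### Pulling back families of measures along equivariant maps. -/

namespace GSpace

variable {G X Y Z : Type*} [TopologicalSpace G] [TopologicalSpace X]
  [TopologicalSpace Y] [TopologicalSpace Z] {H : TopGroupoid G X} {E : FibreSpace X Y}
  {F : FibreSpace X Z}

/-- The fibres of `Y ⋊ G` over `y` and of `Z ⋊ G` over `z` are homeomorphic, if `y` and `z` lie over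
the same unit. -/
def fibreHomeomorph (A : GSpace H E) (B : GSpace H F) {y : Y} {z : Z} (h : E.p y = F.p z) :
    A.semidirect.Fibre y ≃ₜ B.semidirect.Fibre z where
  toFun g := ⟨⟨(z, g.1.1.2), h.symm.trans ((congrArg E.p g.2.symm).trans g.1.2)⟩, rfl⟩
  invFun g := ⟨⟨(y, g.1.1.2), h.trans ((congrArg F.p g.2.symm).trans g.1.2)⟩, rfl⟩
  left_inv g := Subtype.ext (Subtype.ext (Prod.ext g.2.symm rfl))
  right_inv g := Subtype.ext (Subtype.ext (Prod.ext g.2.symm rfl))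
  continuous_toFun := Continuous.subtype_mk (Continuous.subtype_mk (continuous_const.prodMk
    (continuous_snd.comp (continuous_subtype_val.comp continuous_subtype_val))) _) _
  continuous_invFun := Continuous.subtype_mk (Continuous.subtype_mk (continuous_const.prodMk
    (continuous_snd.comp (continuous_subtype_val.comp continuous_subtype_val))) _) _

/-- The integrand depends on `z`, not only on `f z`, so continuity of `m` does not apply directly.
Near `z₀` it is replaced, with uniformly small error, by a fixed function `k` on `G` extending
`φ(z₀, ·)`; since the measures have mass one, the integrals are uniformly close too. -/
theorem continuous_integral_pullback [T2Space G] [LocallyCompactSpace G] [T2Space X]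
    (hH : H.IsEtale) (A : GSpace H E) (B : GSpace H F) {f : Z → Y} (hf : Continuous f)
    (hfp : ∀ z, E.p (f z) = F.p z) (m : A.semidirect.ProbFamily)
    (φ : C_c({q : Z × G // F.p q.1 = H.r q.2}, ℂ)) :
    Continuous fun z => ∫ g, φ (A.fibreHomeomorph B (hfp z) g).1 ∂(m.meas (f z)) := by
  have := E.t2
  have := E.locallyCompact
  rw [continuous_iff_continuousAt]
  intro z₀
  classical
  let K : Set G := (fun q : {q : Z × G // F.p q.1 = H.r q.2} => q.1.2) '' tsupport φ
  have hK : IsCompact K := φ.hasCompactSupport.isCompact.image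
    (continuous_snd.comp continuous_subtype_val)
  have hφK : ∀ q : {q : Z × G // F.p q.1 = H.r q.2}, q.1.2 ∉ K → φ q = 0 := fun q hq =>
    image_eq_zero_of_notMem_tsupport fun h => hq (mem_image_of_mem _ h)
  obtain ⟨k, hkc, hks, hk⟩ := hH.exists_extension (F.p z₀)
    (fun a => if h : F.p z₀ = H.r a then φ ⟨(z₀, a), h⟩ else 0) hK (fun a ha => by
      split_ifs with h
      · exact hφK _ ha
      · rfl)
  have hkφ : ∀ a (h : F.p z₀ = H.r a), φ ⟨(z₀, a), h⟩ = k a := fun a h => by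
    rw [hk a h.symm, dif_pos h]
  have hclose : ∀ ε > 0, ∀ᶠ z in 𝓝 z₀, ∀ a (h : F.p z = H.r a),
      ‖φ ⟨(z, a), h⟩ - k a‖ ≤ ε := by
    intro ε hε
    have hL : IsCompact (K ∪ tsupport k) := hK.union hks
    have h1 : ∀ᶠ z in 𝓝 z₀, ∀ a ∈ K ∪ tsupport k, ∀ h : F.p z = H.r a,
        ‖φ ⟨(z, a), h⟩ - k a‖ ≤ ε := by
      refine hL.eventually_forall_of_forall_eventually fun a _ => ?_
      -- If `(z₀, a)` is not in the fibred product, nearby pairs are not either and the condition is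
      -- vacuous.
      by_cases h : F.p z₀ = H.r a
      · have hD : Continuous fun q : {q : Z × G // F.p q.1 = H.r q.2} => ‖φ q - k q.1.2‖ :=
          ((map_continuous φ).sub (hkc.comp (continuous_snd.comp continuous_subtype_val))).norm
        have h2 : ∀ᶠ q in 𝓝 (⟨(z₀, a), h⟩ : {q : Z × G // F.p q.1 = H.r q.2}),
            ‖φ q - k q.1.2‖ < ε := by
          refine hD.continuousAt.eventually (gt_mem_nhds ?_)
          change ‖φ ⟨(z₀, a), h⟩ - k a‖ < ε
          rwa [hkφ a h, sub_self, norm_zero]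
        rw [nhds_subtype_eq_comap, eventually_comap] at h2
        filter_upwards [h2] with q hq h'
        exact (hq ⟨q, h'⟩ rfl).le
      · have h2 : IsOpen {q : Z × G | F.p q.1 ≠ H.r q.2} :=
          isOpen_ne_fun (F.continuous_p.comp continuous_fst) (H.continuous_r.comp continuous_snd)
        filter_upwards [h2.mem_nhds (show (z₀, a) ∈ _ from h)] with q hq h'
        exact absurd h' hq
    filter_upwards [h1] with z hz a h
    by_cases ha : a ∈ K ∪ tsupport k
    · exact hz a ha h
    · rw [hφK _ fun h' => ha (Or.inl h'),
        image_eq_zero_of_notMem_tsupport fun h' => ha (Or.inr h'), sub_zero, norm_zero]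
      exact hε.le
  -- As a function on `Y ⋊ G`, `k` need not have compact support; the factor `θ`, equal to `1` near
  -- `f z₀`, gives a legitimate test function `ψ` without altering the integrals for `z` near `z₀`.
  obtain ⟨C, hC, hzC⟩ := exists_compact_mem_nhds (f z₀)
  obtain ⟨θ, hθ1, hθc, -, -⟩ := exists_continuousMap_one_of_isCompact_subset_isOpen hC isOpen_univ
    (subset_univ C)
  let ψ : C_c({q : Y × G // E.p q.1 = H.r q.2}, ℂ) :=
    ⟨⟨fun q => θ q.1.1 * k q.1.2,
      (Complex.continuous_ofReal.comp (θ.continuous.comp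
        (continuous_fst.comp continuous_subtype_val))).mul
        (hkc.comp (continuous_snd.comp continuous_subtype_val))⟩, by
      have hcl : IsClosed {q : Y × G | E.p q.1 = H.r q.2} :=
        isClosed_eq (E.continuous_p.comp continuous_fst) (H.continuous_r.comp continuous_snd)
      refine HasCompactSupport.intro
        (hcl.isClosedEmbedding_subtypeVal.isCompact_preimage (hθc.prod hks)) fun q hq => ?_
      change (θ q.1.1 : ℂ) * k q.1.2 = 0
      by_cases h1 : q.1.1 ∈ tsupport θ
      · rw [image_eq_zero_of_notMem_tsupport fun h2 => hq ⟨h1, h2⟩, mul_zero]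
      · rw [image_eq_zero_of_notMem_tsupport h1, Complex.ofReal_zero, zero_mul]⟩
  have hψ : ∀ y ∈ C, ∀ g : A.semidirect.Fibre y, ψ g.1 = k g.1.1.2 := by
    intro y hy g
    have h1 : θ g.1.1.1 = 1 := by
      have h2 : g.1.1.1 = y := g.2
      rw [h2]; exact hθ1 hy
    change (θ g.1.1.1 : ℂ) * k g.1.1.2 = _
    rw [h1, Complex.ofReal_one, one_mul]
  have hJ : Continuous fun z => ∫ g, ψ g.1 ∂(m.meas (f z)) := (m.continuous ψ).comp hf
  have hsmall : ∀ ε > 0, ∀ᶠ z in 𝓝 z₀,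
      ‖(∫ g, φ (A.fibreHomeomorph B (hfp z) g).1 ∂(m.meas (f z)))
        - ∫ g, ψ g.1 ∂(m.meas (f z))‖ ≤ ε := by
    intro ε hε
    filter_upwards [hclose ε hε, hf.continuousAt.eventually hzC] with z hz hzC
    rw [← integral_sub (m.integrable _ φ (u := fun g => (A.fibreHomeomorph B (hfp z) g).1)
      (continuous_subtype_val.comp (A.fibreHomeomorph B (hfp z)).continuous))
      (m.integrable _ ψ continuous_subtype_val)]
    refine (norm_integral_le_of_norm_le_const (C := ε) (Eventually.of_forall fun g => ?_)).trans ?_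
    · rw [hψ _ hzC]
      exact hz _ _
    · simp
  rw [ContinuousAt, Metric.tendsto_nhds]
  intro ε hε
  filter_upwards [hsmall (ε / 3) (by positivity),
    Metric.tendsto_nhds.1 hJ.continuousAt (ε / 3) (by positivity)] with z h1 h2
  have h3 := (hsmall (ε / 3) (by positivity)).self_of_nhds
  rw [← dist_eq_norm] at h1 h3
  rw [dist_comm] at h3
  exact (dist_triangle4 _ (∫ g, ψ g.1 ∂(m.meas (f z))) (∫ g, ψ g.1 ∂(m.meas (f z₀))) _).trans_lt
    (by linarith)

/-- The pullback of a continuous family of probability measures along a map of `G`-spaces. -/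
noncomputable def pullback [T2Space G] [LocallyCompactSpace G] [T2Space X]
    (hH : H.IsEtale) (A : GSpace H E) (B : GSpace H F) {f : Z → Y} (hf : Continuous f)
    (hfp : ∀ z, E.p (f z) = F.p z) (m : A.semidirect.ProbFamily) : B.semidirect.ProbFamily where
  meas z := (m.meas (f z)).map (A.fibreHomeomorph B (hfp z))
  isProbabilityMeasure z :=
    Measure.isProbabilityMeasure_map (A.fibreHomeomorph B (hfp z)).continuous.aemeasurable
  regular z := by
    have := m.regular (f z)
    exact Measure.Regular.map (A.fibreHomeomorph B (hfp z))
  continuous φ := by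
    refine (continuous_integral_pullback hH A B hf hfp m φ).congr fun z => ?_
    exact ((A.fibreHomeomorph B (hfp z)).measurableEmbedding.integral_map
      fun g => φ g.1).symm

/-- The map `Z ⋊ G → Y ⋊ G` induced by a fibre map. -/
def semidirectMap {f : Z → Y} (hfp : ∀ z, E.p (f z) = F.p z)
    (q : {q : Z × G // F.p q.1 = H.r q.2}) : {q : Y × G // E.p q.1 = H.r q.2} :=
  ⟨(f q.1.1, q.1.2), (hfp _).trans q.2⟩

/-- Translation in either semidirect product multiplies the `G`-component only, so it commutes with
the fibre homeomorphisms. Both measures in the defect are thus transported by one measurable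
equivalence, which preserves the mass of the total variation. -/
theorem defect_pullback [T2Space G] [LocallyCompactSpace G] [T2Space X]
    (hH : H.IsEtale) (A : GSpace H E) (B : GSpace H F) {f : Z → Y} (hf : Continuous f)
    (hfp : ∀ z, E.p (f z) = F.p z) (hfe : A.IsEquivariant B f hfp) (m : A.semidirect.ProbFamily)
    (q : {q : Z × G // F.p q.1 = H.r q.2}) :
    (pullback hH A B hf hfp m).defect q = m.defect (semidirectMap hfp q) := by
  have hs : A.semidirect.s (semidirectMap hfp q) = f (B.semidirect.s q) := (hfe _ _ _).symm
  -- The base point `y` is left free because the source of the image arrow equals `f` of the source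
  -- by equivariance, not by definition.
  have hmeas : ∀ (z : Z) (y : Y) (h : y = f z), (pullback hH A B hf hfp m).meas z =
      (m.meas y).map (A.fibreHomeomorph B ((congrArg E.p h).trans (hfp z))) := by
    rintro z _ rfl; rfl
  let e : A.semidirect.Fibre (A.semidirect.r (semidirectMap hfp q)) ≃ᵐ
      B.semidirect.Fibre (B.semidirect.r q) :=
    (A.fibreHomeomorph B (hfp q.1.1)).toMeasurableEquiv
  have h1 : ((pullback hH A B hf hfp m).meas (B.semidirect.s q)).map (B.semidirect.translate q) =
      ((m.meas (A.semidirect.s (semidirectMap hfp q))).map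
        (A.semidirect.translate (semidirectMap hfp q))).map e := by
    rw [hmeas _ _ hs, Measure.map_map (B.semidirect.continuous_translate q).measurable
      (Homeomorph.continuous _).measurable,
      Measure.map_map e.measurable
        (A.semidirect.continuous_translate _).measurable]
    rfl
  have h2 : (pullback hH A B hf hfp m).meas (B.semidirect.r q) =
      (m.meas (A.semidirect.r (semidirectMap hfp q))).map e := rfl
  rw [TopGroupoid.ProbFamily.defect, TopGroupoid.ProbFamily.defect,
    totalVariation_sub_map e h1 h2,
    measureReal_def, measureReal_def, MeasurableEquiv.map_apply, preimage_univ]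

/-- A `G`-space that maps equivariantly to an amenable `G`-space is amenable. -/
theorem IsAmenable.of_equivariant {G X Y Z : Type u} [TopologicalSpace G] [TopologicalSpace X]
    [TopologicalSpace Y] [TopologicalSpace Z] {H : TopGroupoid G X} {E : FibreSpace X Y}
    {F : FibreSpace X Z} [T2Space G] [LocallyCompactSpace G] [T2Space X] (hH : H.IsEtale)
    {A : GSpace H E} {B : GSpace H F} {f : Z → Y} (hf : Continuous f)
    (hfp : ∀ z, E.p (f z) = F.p z) (hfe : A.IsEquivariant B f hfp) (hA : A.IsAmenable) :
    B.IsAmenable := by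
  obtain ⟨ι, i1, i2, i3, m, hm⟩ := hA
  refine ⟨ι, i1, i2, i3, fun i => pullback hH A B hf hfp (m i), fun K hK => ?_⟩
  have hc : Continuous (semidirectMap (H := H) hfp) := Continuous.subtype_mk
    ((hf.comp (continuous_fst.comp continuous_subtype_val)).prodMk
      (continuous_snd.comp continuous_subtype_val)) _
  have h1 := (hm _ (hK.image hc)).comp (semidirectMap hfp)
  refine (h1.mono (subset_preimage_image _ K)).congr (Eventually.of_forall fun i q _ => ?_)
  exact (defect_pullback hH A B hf hfp hfe (m i) q).symm

end GSpace

/-! ### The proposition. -/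

theorem mainTheorem3 {G X : Type u} [TopologicalSpace G] [TopologicalSpace X]
    [T2Space G] [LocallyCompactSpace G] [T2Space X] [LocallyCompactSpace X]
    (H : TopGroupoid G X) (hH : H.IsEtale) :
    ∃ B : GSpace H H.rangeFibreSpace.beta,
      B.Extends H.leftTranslation ∧
      (∀ B' : GSpace H H.rangeFibreSpace.beta, B'.Extends H.leftTranslation → B' = B) ∧
      (H.IsStronglyAmenableAtInfinity ↔ B.IsAmenable) := by
  refine ⟨hH.betaGSpace, hH.extends_betaGSpace,
    fun B' hB' => hH.eq_of_extends hB' hH.extends_betaGSpace, ?_, fun hB => ?_⟩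
  · rintro ⟨Y, _, E, A, hE, hA, σ, hσ, hσp⟩
    obtain ⟨f, hfp, hf, hfe⟩ := hH.exists_equivariant A hE hσ hσp
    exact hA.of_equivariant hH hf hfp hfe
  · refine ⟨_, _, H.rangeFibreSpace.beta, hH.betaGSpace,
      H.rangeFibreSpace.isFibrewiseCompact_beta, hB, fun x => H.rangeFibreSpace.toBeta (H.unit x),
      H.rangeFibreSpace.continuous_toBeta.comp H.continuous_unit, fun x => ?_⟩
    exact (H.rangeFibreSpace.betaProj_toBeta _).trans (H.r_unit x)
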